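/- Let $V=\mathbb Z^2$, $\tilde V$ and $E$ be the sets of vertices, faces and unoriented edges of the infinite square lattice in the plane, and let $\mathcal A$ be the quasi-local algebra of a system of qubits on the edges: the $C^\ast$-closure of $\mathcal A_{\rm loc}=\bigcup_\Lambda \mathcal A_\Lambda$, where $\Lambda$ runs over the finite subsets of $E$, $\mathcal A_\Lambda=\mathbb B\big(\bigotimes_{e\in\Lambda}\mathbb C^2\big)$, and $\mathcal A_\Lambda\subseteq\mathcal A_{\Lambda'}$ through $a\mapsto a\otimes 1_{\Lambda'\setminus\Lambda}$ for $\Lambda\subseteq\Lambda'$. For $v\in V$ and $\tilde v\in\tilde V$ let $$A_v=\prod_{e\ni v}\sigma^x_e,\qquad B_{\tilde v}=\prod_{e\in\tilde v}\sigma^z_e$$ be the star and face operators of Kitaev's toric code, where $\sigma^x_e,\sigma^z_e\in\mathcal A_{\{e\}}$ are the Pauli matrices at $e$, and $e\in\tilde v$ means that $e$ belongs to the boundary of the face $\tilde v$. Put $W=V\sqcup\tilde V$, let $S_w=A_w$ for $w\in V$ and $S_w=B_w$ for $w\in\tilde V$, and let $\mathcal C=C^\ast\{S_w : w\in W\}\subseteq\mathcal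 A$. Let $\Omega=\{-1,1\}^W$ be the set of functions $f\colon W\to\{-1,1\}$. Then $\mathcal A$ is isomorphic to the UHF algebra $M_{2^\infty}$, and the following hold. 1. For every $f\in\Omega$ there is exactly one (continuous) unital multiplicative linear functional $\omega_f$ on $\mathcal C$ with $\omega_f(S_w)=f(w)$ for all $w\in W$, and the pure states of $\mathcal C$ are exactly the functionals $\omega_f$, $f\in\Omega$. 2. For every $f\in\Omega$ there is a pure state of $\mathcal A$ that extends $\omega_f$, and it is the only state of $\mathcal A$ that extends $\omega_f$. 3. $\mathcal C$ is a $C^\ast$-diagonal of $\mathcal A\cong M_{2^\infty}$. That is, $\mathcal C$ is a sub-$C^\ast$-algebra of $\mathcal A$ such that: (a) $\mathcal C$ is a masa, meaning that the relative commutant of $\mathcal C$ in $\mathcal A$ is $\mathcal C$ itself; (b) $\mathcal C$ is regular, meaning that the normalizers of $\mathcal C$, i.e. the elements $a\in\mathcal A$ with $a\,\mathcal C\,a^\ast\cup a^\ast\mathcal C\,a\subseteq\mathcal C$, generate $\mathcal A$ as a $C^\ast$-algebra; (c) $\mathcal C$ has the unique extension property, meaning that every pure state of $\mathcal C$ has exactly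 one extension to a pure state of $\mathcal A$. -/

import Mathlib

noncomputable section

/-! ### The quasi-local algebra of a system of qubits indexed by a set `E` -/

namespace SpinSystem

variable {E : Type}

/-- Configurations of classical bits on `E`: labels of the product basis vectors. -/
abbrev Config (E : Type) : Type := E → Fin 2

/-- The Hilbert space on which the local algebras are represented: it has an orthonormal basis
labelled by all configurations. For every finite `Λ` it is `ℋ_Λ ⊗ ℋ'`, with `ℋ_Λ = ⊗_{e ∈ Λ} ℂ²`
and `ℋ'` the space with basis the configurations outside `Λ`. -/
abbrev ConfigSpace (E : Type) : Type := lp (fun _ : Config E => ℂ) 2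

/-- The matrix algebra `𝒜_Λ = 𝔹(ℋ_Λ)`, written in the product basis of `ℋ_Λ = ⊗_{e ∈ Λ} ℂ²`. -/
abbrev LocalMatrix (Λ : Finset E) : Type := Matrix (Λ → Fin 2) (Λ → Fin 2) ℂ

/-- Restriction of a configuration to `Λ`. -/
def restr (Λ : Finset E) (s : Config E) : Λ → Fin 2 := fun e => s e

/-- Translating the configurations by `u` preserves square summability (and the norm). -/
theorem memℓp_shift (u : Config E) (ψ : ConfigSpace E) :
    Memℓp (fun s : Config E => ψ (s + u)) 2 := by
  refine memℓp_gen ?_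
  exact ((Equiv.addRight u).summable_iff (f := fun s => ‖ψ s‖ ^ (2 : ENNReal).toReal)).2
    ((lp.memℓp ψ).summable (by norm_num))

theorem norm_shift (u : Config E) (ψ : ConfigSpace E) :
    ‖(⟨fun s : Config E => ψ (s + u), memℓp_shift u ψ⟩ : ConfigSpace E)‖ = ‖ψ‖ := by
  rw [lp.norm_eq_tsum_rpow (by norm_num), lp.norm_eq_tsum_rpow (by norm_num)]
  congr 1
  exact (Equiv.addRight u).tsum_eq (fun s => ‖ψ s‖ ^ (2 : ENNReal).toReal)

variable [DecidableEq E]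

/-- The configuration that is `t` on `Λ` and `s` off `Λ`. -/
def patch (Λ : Finset E) (s : Config E) (t : Λ → Fin 2) : Config E :=
  fun e => if h : e ∈ Λ then t ⟨e, h⟩ else s e

theorem restr_patch (Λ : Finset E) (s : Config E) (t : Λ → Fin 2) :
    restr Λ (patch Λ s t) = t := by
  funext e
  simp [restr, patch]

theorem patch_patch (Λ : Finset E) (s : Config E) (t t' : Λ → Fin 2) :
    patch Λ (patch Λ s t) t' = patch Λ s t' := by
  funext e
  by_cases h : e ∈ Λ <;> simp [patch, h]

theorem patch_restr (Λ : Finset E) (s : Config E) : patch Λ s (restr Λ s) = s := by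
  funext e
  by_cases h : e ∈ Λ <;> simp [patch, restr]

/-- `(a ⊗ 1) ψ` for a matrix `a` on `Λ`, as a function of configurations. -/
def localFun (Λ : Finset E) (a : LocalMatrix Λ) (ψ : Config E → ℂ) : Config E → ℂ :=
  fun s => ∑ t : Λ → Fin 2, a (restr Λ s) t * ψ (patch Λ s t)

theorem patch_eq_add (Λ : Finset E) (s : Config E) (t : Λ → Fin 2) :
    patch Λ s t = s + patch Λ 0 (t - restr Λ s) := by
  funext e
  by_cases h : e ∈ Λ <;> simp [patch, h, restr]

theorem localFun_eq (Λ : Finset E) (a : LocalMatrix Λ) (ψ : Config E → ℂ) (s : Config E) :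
    localFun Λ a ψ s =
      ∑ u : Λ → Fin 2, a (restr Λ s) (restr Λ s + u) * ψ (s + patch Λ 0 u) := by
  unfold localFun
  refine Fintype.sum_equiv (Equiv.subRight (restr Λ s)) _ _ fun t => ?_
  rw [patch_eq_add]
  simp

theorem norm_entry_le (Λ : Finset E) (a : LocalMatrix Λ) (i j : Λ → Fin 2) :
    ‖a i j‖ ≤ ∑ i, ∑ j, ‖a i j‖ :=
  (Finset.single_le_sum (f := fun j => ‖a i j‖) (fun _ _ => norm_nonneg _)
    (Finset.mem_univ j)).trans
    (Finset.single_le_sum (f := fun i => ∑ j, ‖a i j‖)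
      (fun _ _ => Finset.sum_nonneg fun _ _ => norm_nonneg _) (Finset.mem_univ i))

theorem memℓp_term (Λ : Finset E) (a : LocalMatrix Λ) (ψ : ConfigSpace E) (u : Λ → Fin 2) :
    Memℓp (fun s : Config E => a (restr Λ s) (restr Λ s + u) * ψ (s + patch Λ 0 u)) 2 := by
  refine Memℓp.mono' ((memℓp_shift (patch Λ 0 u) ψ).const_mul
    ((∑ i, ∑ j, ‖a i j‖ : ℝ) : ℂ)) fun s => ?_
  rw [norm_mul, norm_mul, Complex.norm_real]
  gcongr
  exact (norm_entry_le Λ a _ _).trans (Real.le_norm_self _)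

theorem norm_term_le (Λ : Finset E) (a : LocalMatrix Λ) (ψ : ConfigSpace E) (u : Λ → Fin 2) :
    ‖(⟨_, memℓp_term Λ a ψ u⟩ : ConfigSpace E)‖ ≤ (∑ i, ∑ j, ‖a i j‖) * ‖ψ‖ := by
  have hC : 0 ≤ ∑ i, ∑ j, ‖a i j‖ :=
    Finset.sum_nonneg fun _ _ => Finset.sum_nonneg fun _ _ => norm_nonneg _
  have h := lp.norm_mono (p := 2) (by norm_num) (x := ⟨_, memℓp_term Λ a ψ u⟩)
    (y := ((∑ i, ∑ j, ‖a i j‖ : ℝ) : ℂ) • (⟨_, memℓp_shift (patch Λ 0 u) ψ⟩ : ConfigSpace E))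
    (fun s => by
      change ‖a (restr Λ s) (restr Λ s + u) * ψ (s + patch Λ 0 u)‖ ≤
        ‖((∑ i, ∑ j, ‖a i j‖ : ℝ) : ℂ) * ψ (s + patch Λ 0 u)‖
      rw [norm_mul, norm_mul, Complex.norm_real]
      gcongr
      exact (norm_entry_le Λ a _ _).trans (Real.le_norm_self _))
  rw [norm_smul, norm_shift, Complex.norm_real, Real.norm_of_nonneg hC] at h
  exact h

theorem memℓp_localFun (Λ : Finset E) (a : LocalMatrix Λ) (ψ : ConfigSpace E) :
    Memℓp (localFun Λ a ψ) 2 := by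
  have h := Memℓp.finsetSum (Finset.univ : Finset (Λ → Fin 2)) fun u _ => memℓp_term Λ a ψ u
  convert h using 1
  funext s
  exact localFun_eq Λ a ψ s

theorem norm_localFun_le (Λ : Finset E) (a : LocalMatrix Λ) (ψ : ConfigSpace E) :
    ‖(⟨_, memℓp_localFun Λ a ψ⟩ : ConfigSpace E)‖ ≤
      (Fintype.card (Λ → Fin 2) * ∑ i, ∑ j, ‖a i j‖) * ‖ψ‖ := by
  have h : (⟨_, memℓp_localFun Λ a ψ⟩ : ConfigSpace E) =
      ∑ u : Λ → Fin 2, (⟨_, memℓp_term Λ a ψ u⟩ : ConfigSpace E) := by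
    apply lp.ext
    rw [lp.coeFn_sum]
    funext s
    rw [Finset.sum_apply]
    exact localFun_eq Λ a ψ s
  rw [h]
  refine (norm_sum_le_of_le _ fun u _ => norm_term_le Λ a ψ u).trans ?_
  rw [Finset.sum_const, nsmul_eq_mul, Finset.card_univ, mul_assoc]

/-- The bounded operator `a ⊗ 1`. -/
def localOp (Λ : Finset E) (a : LocalMatrix Λ) : ConfigSpace E →L[ℂ] ConfigSpace E :=
  LinearMap.mkContinuous
    { toFun := fun ψ => ⟨localFun Λ a ψ, memℓp_localFun Λ a ψ⟩
      map_add' := fun ψ φ => lp.ext <| by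
        funext s
        change localFun Λ a _ s = localFun Λ a ψ s + localFun Λ a φ s
        simp [localFun, mul_add, Finset.sum_add_distrib]
      map_smul' := fun c ψ => lp.ext <| by
        funext s
        change localFun Λ a _ s = c * localFun Λ a ψ s
        simp only [localFun, lp.coeFn_smul, Pi.smul_apply, smul_eq_mul, Finset.mul_sum]
        exact Finset.sum_congr rfl fun _ _ => by ring }
    _ (norm_localFun_le Λ a)

theorem localOp_apply (Λ : Finset E) (a : LocalMatrix Λ) (ψ : ConfigSpace E) (s : Config E) :
    localOp Λ a ψ s = ∑ t : Λ → Fin 2, a (restr Λ s) t * ψ (patch Λ s t) := rfl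

open Classical in
/-- The matrix entries of `a ⊗ 1` in the product basis. -/
theorem localOp_single (Λ : Finset E) (a : LocalMatrix Λ) (s t : Config E) (c : ℂ) :
    localOp Λ a (lp.single 2 t c) s =
      if ∀ e ∉ Λ, s e = t e then a (restr Λ s) (restr Λ t) * c else 0 := by
  classical
  rw [localOp_apply]
  by_cases h : ∀ e ∉ Λ, s e = t e
  · rw [if_pos h, Finset.sum_eq_single (restr Λ t)]
    · have : patch Λ s (restr Λ t) = t := by
        funext e
        by_cases he : e ∈ Λ <;> simp [patch, he, restr, h]
      rw [this, lp.single_apply_self]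
    · intro r _ hr
      rw [lp.single_apply_ne, mul_zero]
      rintro rfl
      exact hr (restr_patch Λ s r).symm
    · simp
  · rw [if_neg h]
    refine Finset.sum_eq_zero fun r _ => ?_
    rw [lp.single_apply_ne, mul_zero]
    rintro rfl
    exact h fun e he => by simp [patch, he]

theorem localOp_star (Λ : Finset E) (a : LocalMatrix Λ) :
    localOp Λ (star a) = star (localOp Λ a) := by
  classical
  refine lp.ext_continuousLinearMap (by norm_num) fun t => ?_
  refine ContinuousLinearMap.ext fun c => lp.ext (funext fun s => ?_)
  change localOp Λ (star a) (lp.single 2 t c) s = (star (localOp Λ a) (lp.single 2 t c)) s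
  have h1 := lp.inner_single_left (𝕜 := ℂ) s (1 : ℂ) (star (localOp Λ a) (lp.single 2 t c))
  rw [ContinuousLinearMap.star_eq_adjoint, ContinuousLinearMap.adjoint_inner_right,
    lp.inner_single_right, localOp_single] at h1
  rw [localOp_single, ContinuousLinearMap.star_eq_adjoint]
  have h2 : ∀ z : ℂ, inner ℂ (1 : ℂ) z = z := fun z => by simp
  rw [h2] at h1
  rw [← h1]
  by_cases h : ∀ e ∉ Λ, s e = t e
  · rw [if_pos h, if_pos fun e he => (h e he).symm]
    simp [Matrix.star_apply, mul_comm]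
  · rw [if_neg h, if_neg fun h' => h fun e he => (h' e he).symm]
    simp

theorem localOp_mul (Λ : Finset E) (a b : LocalMatrix Λ) :
    localOp Λ (a * b) = localOp Λ a * localOp Λ b := by
  ext ψ s
  change localOp Λ (a * b) ψ s = localOp Λ a (localOp Λ b ψ) s
  simp only [localOp_apply, restr_patch, patch_patch, Matrix.mul_apply, Finset.sum_mul,
    Finset.mul_sum]
  rw [Finset.sum_comm]
  exact Finset.sum_congr rfl fun _ _ => Finset.sum_congr rfl fun _ _ => by ring

theorem localOp_algebraMap (Λ : Finset E) (c : ℂ) :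
    localOp Λ (algebraMap ℂ _ c) = algebraMap ℂ _ c := by
  ext ψ s
  change localOp Λ (algebraMap ℂ _ c) ψ s = c * ψ s
  rw [localOp_apply, Finset.sum_eq_single (restr Λ s)]
  · simp [patch_restr, Matrix.algebraMap_matrix_apply]
  · intro t _ ht
    simp [Matrix.algebraMap_matrix_apply, ht.symm]
  · simp

/-- The representation `a ↦ a ⊗ 1` of the matrix algebra `𝒜_Λ`. -/
def localEmbed (Λ : Finset E) :
    LocalMatrix Λ →⋆ₐ[ℂ] (ConfigSpace E →L[ℂ] ConfigSpace E) where
  toFun := localOp Λ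
  map_one' := by simpa using localOp_algebraMap Λ 1
  map_mul' := localOp_mul Λ
  map_zero' := by simpa using localOp_algebraMap Λ 0
  map_add' a b := by
    ext ψ s
    change localOp Λ (a + b) ψ s = localOp Λ a ψ s + localOp Λ b ψ s
    simp [localOp_apply, add_mul, Finset.sum_add_distrib]
  commutes' := localOp_algebraMap Λ
  map_star' := localOp_star Λ

/-- The natural inclusion `a ↦ a ⊗ 1_{Λ' \ Λ}` of matrix algebras, for `Λ ⊆ Λ'`. -/
def extendMatrix {Λ Λ' : Finset E} (h : Λ ⊆ Λ') (a : LocalMatrix Λ) : LocalMatrix Λ' :=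
  Matrix.of fun s t => if ∀ e : Λ', (e : E) ∉ Λ → s e = t e then
    a (fun e => s ⟨e, h e.2⟩) (fun e => t ⟨e, h e.2⟩) else 0

/-- Each `𝒜_Λ` is represented faithfully, so that the representation is isometric. -/
theorem localEmbed_injective (Λ : Finset E) : Function.Injective (localEmbed Λ) := by
  classical
  intro a b hab
  ext i j
  have h := congrArg (fun T : ConfigSpace E →L[ℂ] ConfigSpace E =>
    T (lp.single 2 (patch Λ 0 j) (1 : ℂ)) (patch Λ 0 i)) hab
  change localOp Λ a _ _ = localOp Λ b _ _ at h
  rw [localOp_single, localOp_single, restr_patch, restr_patch,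
    if_pos fun e he => by simp [patch, he], if_pos fun e he => by simp [patch, he]] at h
  simpa using h

/-- The representations are compatible with the natural inclusions. Hence the union of their
ranges is the algebra `⋃_Λ 𝒜_Λ` of local observables. -/
theorem localEmbed_extendMatrix {Λ Λ' : Finset E} (h : Λ ⊆ Λ') (a : LocalMatrix Λ) :
    localEmbed Λ' (extendMatrix h a) = localEmbed Λ a := by
  classical
  refine lp.ext_continuousLinearMap (𝕜 := ℂ) (by norm_num) fun t => ?_
  refine ContinuousLinearMap.ext fun c => lp.ext (funext fun s => ?_)
  change localOp Λ' (extendMatrix h a) (lp.single 2 t c) s = localOp Λ a (lp.single 2 t c) s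
  rw [localOp_single, localOp_single]
  by_cases h1 : ∀ e ∉ Λ, s e = t e
  · rw [if_pos h1, if_pos fun e he => h1 e fun he' => he (h he')]
    congr 1
    exact if_pos (c := ∀ e : Λ', (e : E) ∉ Λ → restr Λ' s e = restr Λ' t e)
      fun e he => h1 e he
  · rw [if_neg h1]
    by_cases h2 : ∀ e ∉ Λ', s e = t e
    · rw [if_pos h2]
      refine mul_eq_zero_of_left (if_neg fun h3 => ?_) c
      refine h1 fun e he => ?_
      by_cases he' : e ∈ Λ'
      · exact h3 ⟨e, he'⟩ he
      · exact h2 e he'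
    · rw [if_neg h2]

variable (E) in
/-- The algebra `𝒜_loc = ⋃_Λ 𝒜_Λ` of local observables (the supremum is over a directed family). -/
def localAlgebra : StarSubalgebra ℂ (ConfigSpace E →L[ℂ] ConfigSpace E) :=
  ⨆ Λ : Finset E, (localEmbed Λ).range

variable (E) in
/-- The quasi-local algebra: the C⋆-closure of the algebra of local observables. -/
abbrev quasiLocal : StarSubalgebra ℂ (ConfigSpace E →L[ℂ] ConfigSpace E) :=
  (localAlgebra E).topologicalClosure

variable (E) in
/-- The quasi-local algebra `𝒜 = ⊗_{e ∈ E} M₂(ℂ)` as a C⋆-algebra. -/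
abbrev QuasiLocal : Type := quasiLocal E

instance : CStarAlgebra (QuasiLocal E) :=
  StarSubalgebra.cstarAlgebra (quasiLocal E)
    (h_closed := StarSubalgebra.isClosed_topologicalClosure _)

theorem localEmbed_mem (Λ : Finset E) (a : LocalMatrix Λ) : localEmbed Λ a ∈ quasiLocal E :=
  StarSubalgebra.le_topologicalClosure _
    ((le_iSup (fun Λ : Finset E => (localEmbed Λ).range) Λ) ⟨a, rfl⟩)

/-- The matrix `m ∈ M₂(ℂ)` acting on the site `e`, as an element of `𝒜_{e} ⊆ 𝒜`. -/
def siteOp (e : E) (m : Matrix (Fin 2) (Fin 2) ℂ) : QuasiLocal E :=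
  ⟨localEmbed {e} (Matrix.of fun s t => m (s ⟨e, Finset.mem_singleton_self e⟩)
    (t ⟨e, Finset.mem_singleton_self e⟩)), localEmbed_mem _ _⟩

/-- The Pauli matrix `σ^x` at the site `e`. -/
def sigmaX (e : E) : QuasiLocal E := siteOp e !![0, 1; 1, 0]

/-- The Pauli matrix `σ^z` at the site `e`. -/
def sigmaZ (e : E) : QuasiLocal E := siteOp e !![1, 0; 0, -1]

end SpinSystem

/-! ### States, and C⋆-diagonals -/

namespace CStarDiagonal

section States

variable {A : Type*} [Ring A] [StarRing A] [Algebra ℂ A] [TopologicalSpace A]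

open scoped ComplexOrder in
/-- A state: a positive linear functional that takes the value `1` at the unit. -/
def IsState (φ : A →L[ℂ] ℂ) : Prop := (∀ a : A, 0 ≤ φ (star a * a)) ∧ φ 1 = 1

/-- A pure state: an extreme point of the convex set of states. -/
def IsPureState (φ : A →L[ℂ] ℂ) : Prop := φ ∈ Set.extremePoints ℝ {ψ : A →L[ℂ] ℂ | IsState ψ}

/-- `η` is an extension to `A` of the functional `ω` on the subalgebra `B`. -/
def Extends [StarModule ℂ A] {B : StarSubalgebra ℂ A} (ω : B →L[ℂ] ℂ) (η : A →L[ℂ] ℂ) : Prop :=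
  ∀ b : B, η (b : A) = ω b

end States

variable {A : Type*} [CStarAlgebra A]

/-- `B` is maximal abelian: its relative commutant in `A` is `B` itself. -/
def IsMasa (B : StarSubalgebra ℂ A) : Prop := Set.centralizer (B : Set A) = (B : Set A)

/-- `a` is a normalizer of `B`: `a B a* ∪ a* B a ⊆ B`. -/
def IsNormalizer (B : StarSubalgebra ℂ A) (a : A) : Prop :=
  ∀ b ∈ B, a * b * star a ∈ B ∧ star a * b * a ∈ B

/-- `B` is regular: its normalizers generate `A` as a C⋆-algebra. -/
def IsRegular (B : StarSubalgebra ℂ A) : Prop :=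
  (StarAlgebra.adjoin ℂ {a : A | IsNormalizer B a}).topologicalClosure = ⊤

/-- The unique extension property: every pure state of `B` has exactly one extension to a pure
state of `A`. -/
def HasUniqueExtension (B : StarSubalgebra ℂ A) : Prop :=
  ∀ ω : B →L[ℂ] ℂ, IsPureState ω → ∃! η : A →L[ℂ] ℂ, IsPureState η ∧ Extends ω η

/-- `B` is a C⋆-diagonal of `A`: a (norm closed) sub-C⋆-algebra that is a regular masa and has the
unique extension property. -/
structure IsCStarDiagonal (B : StarSubalgebra ℂ A) : Prop where
  isClosed : IsClosed (B : Set A)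
  isMasa : IsMasa B
  isRegular : IsRegular B
  hasUniqueExtension : HasUniqueExtension B

variable (A) in
/-- `A` is the UHF algebra `M_{2^∞}`: the closure of the union of an increasing sequence of unital
⋆-subalgebras, the `n`-th of which is a copy of the algebra of `2ⁿ × 2ⁿ` matrices. -/
def IsUHFTwoInfty : Prop :=
  ∃ M : ℕ → StarSubalgebra ℂ A, Monotone M ∧
    (∀ n, Nonempty (M n ≃⋆ₐ[ℂ] Matrix (Fin (2 ^ n)) (Fin (2 ^ n)) ℂ)) ∧
    (⨆ n, M n).topologicalClosure = ⊤

end CStarDiagonal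

/-! ### The toric code -/

namespace ToricCode

open SpinSystem CStarDiagonal

/-- The vertices of the square lattice. -/
abbrev Vertex : Type := ℤ × ℤ

/-- The faces of the square lattice, each named by its lower left corner. -/
abbrev Face : Type := ℤ × ℤ

/-- The unoriented edges of the square lattice: `(v, false)` is the horizontal edge from `v` to
`v + (1, 0)`, and `(v, true)` is the vertical edge from `v` to `v + (0, 1)`. -/
abbrev Edge : Type := Vertex × Bool

/-- The horizontal edge from `v` to `v + (1, 0)`. -/
def hEdge (v : Vertex) : Edge := (v, false)

/-- The vertical edge from `v` to `v + (0, 1)`. -/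
def vEdge (v : Vertex) : Edge := (v, true)

/-- The quasi-local algebra of the qubits on the edges of the square lattice. -/
abbrev Algebra : Type := QuasiLocal Edge

/-- The star operator `A_v = ∏_{e ∋ v} σ_e^x` (the factors commute). -/
def starOp (v : Vertex) : Algebra :=
  sigmaX (hEdge v) * sigmaX (vEdge v) * sigmaX (hEdge (v - (1, 0))) * sigmaX (vEdge (v - (0, 1)))

/-- The face operator `B_p = ∏_{e ∈ p} σ_e^z` (the factors commute): the edges in the boundary of
the face with lower left corner `p` are the bottom, left, top and right one. -/
def faceOp (p : Face) : Algebra :=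
  sigmaZ (hEdge p) * sigmaZ (vEdge p) * sigmaZ (hEdge (p + (0, 1))) * sigmaZ (vEdge (p + (1, 0)))

/-- `S_w`, for `w` a vertex or a face: the star operator or the face operator of `w`. -/
def stabilizer : Vertex ⊕ Face → Algebra := Sum.elim starOp faceOp

/-- The sub-C⋆-algebra `𝒞 = C⋆{A_v, B_p}` generated by the star and face operators. -/
def diagonal : StarSubalgebra ℂ Algebra :=
  (StarAlgebra.adjoin ℂ (Set.range stabilizer)).topologicalClosure

theorem stabilizer_mem (w : Vertex ⊕ Face) : stabilizer w ∈ diagonal :=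
  StarSubalgebra.le_topologicalClosure _ (StarAlgebra.subset_adjoin ℂ _ ⟨w, rfl⟩)

/-- `S_w` as an element of `𝒞`. -/
def stabilizerElt (w : Vertex ⊕ Face) : diagonal := ⟨stabilizer w, stabilizer_mem w⟩

/-- `ω` is the evaluation `ω_f` at `f ∈ Ω = {-1, 1}^W`: the multiplicative linear functional on `𝒞`
with `ω(S_w) = f(w)` for all `w`. The group `ℤˣ` is `{-1, 1}`. -/
structure IsEvaluation (f : Vertex ⊕ Face → ℤˣ) (ω : diagonal →L[ℂ] ℂ) : Prop where
  map_one : ω 1 = 1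
  map_mul : ∀ a b, ω (a * b) = ω a * ω b
  map_stabilizer : ∀ w, ω (stabilizerElt w) = ((f w : ℤ) : ℂ)

end ToricCode

end

/-!
The star and face operators are commuting self-adjoint unitaries. A state that takes the value `±1`
on each of them is multiplicative along `𝒞`, so it is determined on `𝒞` by its signs, and being
extreme is the same as having such signs. On all of `𝒜` it vanishes on every operator that
anticommutes with some generator. The finite products of Pauli matrices (Pauli strings) span a dense
subspace, and each of them commutes or anticommutes with each generator; those that commute with
every generator are, up to a phase, products of generators. Hence the signs determine the state on
`𝒜`, and averaging over conjugation by the generators moves the commutant of `𝒞` into `𝒞`.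

Pauli strings multiply like vectors over `𝔽₂`, with commutation governed by a symplectic form. In
this language the fact about commuting strings is a discrete Poincaré lemma on `ℤ²`: a finitely
supported chain orthogonal to all stars is a sum of faces, and dually. Linear independence of the
stars and of the faces provides, for any finite set of generators, a Pauli string that flips the
sign of exactly one of them; weak-⋆ compactness of the state space then yields a state with any
prescribed signs.
-/

noncomputable section

namespace CStarDiagonal

open scoped ComplexOrder InnerProductSpace

theorem units_cast_mul_self (u : ℤˣ) : ((u : ℤ) : ℂ) * ((u : ℤ) : ℂ) = 1 := by
  rw [← Int.cast_mul, Int.units_coe_mul_self, Int.cast_one]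

/-- A symmetry, in the operator-theoretic sense: a self-adjoint unitary. -/
structure IsSymmetry {A : Type*} [Mul A] [One A] [Star A] (s : A) : Prop where
  isSelfAdjoint : IsSelfAdjoint s
  mul_self : s * s = 1

section Symmetry

variable {A : Type*} [Ring A] [StarRing A] {s : A}

theorem IsSymmetry.neg (hs : IsSymmetry s) : IsSymmetry (-s) :=
  ⟨hs.isSelfAdjoint.neg, by rw [neg_mul_neg, hs.mul_self]⟩

theorem IsSymmetry.units_smul (hs : IsSymmetry s) (u : ℤˣ) : IsSymmetry (u • s) := by
  rcases Int.units_eq_one_or u with rfl | rfl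
  · rwa [one_smul]
  · simpa only [Units.neg_smul, one_smul] using hs.neg

theorem IsSymmetry.mem_unitary (hs : IsSymmetry s) : s ∈ unitary A := by
  simp only [Unitary.mem_iff, hs.isSelfAdjoint.star_eq, hs.mul_self, and_self]

theorem IsSymmetry.star_sub_mul_sub (hs : IsSymmetry s) :
    star (1 - s) * (1 - s) = (1 - s) + (1 - s) := by
  rw [star_sub, star_one, hs.isSelfAdjoint.star_eq, mul_sub, sub_mul, sub_mul, hs.mul_self]
  noncomm_ring

theorem IsSymmetry.isStarProjection [Algebra ℂ A] [StarModule ℂ A] (hs : IsSymmetry s) :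
    IsStarProjection ((2⁻¹ : ℂ) • (1 + s)) where
  isIdempotentElem := by
    rw [IsIdempotentElem, smul_mul_smul_comm, add_mul, mul_add, mul_add, hs.mul_self, one_mul,
      mul_one, one_mul]
    module
  isSelfAdjoint := by
    simp only [IsSelfAdjoint, star_smul, star_add, star_one, hs.isSelfAdjoint.star_eq, star_inv₀,
      star_ofNat]

end Symmetry

section States

variable {A : Type*} [Ring A] [StarRing A] [Algebra ℂ A] [TopologicalSpace A] {φ : A →L[ℂ] ℂ}

theorem IsState.map_star [StarModule ℂ A] (hφ : IsState φ) (a : A) :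
    φ (star a) = starRingEnd ℂ (φ a) := by
  have expand (c : ℂ) : φ (star (c • 1 + a) * (c • 1 + a)) =
      star c * c + star c * φ a + c * φ (star a) + φ (star a * a) := by
    simp only [star_add, star_smul, star_one, add_mul, mul_add, smul_mul_assoc, mul_smul_comm,
      one_mul, mul_one, map_add, map_smul, hφ.2, smul_eq_mul]
    ring
  have im_zero (b : A) : (φ (star b * b)).im = 0 := (Complex.le_def.1 (hφ.1 b)).2.symm
  have h_one := im_zero ((1 : ℂ) • 1 + a)
  have h_I := im_zero (Complex.I • 1 + a)
  simp only [expand, Complex.add_im, im_zero] at h_one h_I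
  simp only [star_one, mul_one, Complex.one_im, one_mul, zero_add, add_zero, RCLike.star_def,
    Complex.conj_I, neg_mul, Complex.I_mul_I, neg_neg, Complex.neg_im, Complex.mul_im,
    Complex.I_re, zero_mul, Complex.I_im] at h_one h_I
  refine Complex.ext ?_ ?_
  · simpa using by linarith
  · simpa using by linarith

/-- The positive form `(a, b) ↦ φ (a* b)` of the Gelfand-Naimark-Segal construction. -/
abbrev IsState.preInnerProductCore [StarModule ℂ A] (hφ : IsState φ) :
    PreInnerProductSpace.Core ℂ A where
  inner a b := φ (star a * b)
  conj_inner_symm a b := by rw [← hφ.map_star, star_mul, star_star]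
  re_inner_nonneg a := (Complex.le_def.1 (hφ.1 a)).1
  add_left a b c := by rw [star_add, add_mul, map_add]
  smul_left a b c := by rw [star_smul, smul_mul_assoc, map_smul]; rfl

theorem IsState.map_star_mul_eq_zero [StarModule ℂ A] (hφ : IsState φ) {d : A}
    (hd : φ (star d * d) = 0) (a : A) : φ (star d * a) = 0 := by
  have cauchy_schwarz :=
    @InnerProductSpace.Core.inner_mul_inner_self_le ℂ A _ _ _ hφ.preInnerProductCore d a
  change ‖φ (star d * a)‖ * ‖φ (star a * d)‖ ≤
    (φ (star d * d)).re * (φ (star a * a)).re at cauchy_schwarz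
  have norm_symm : ‖φ (star a * d)‖ = ‖φ (star d * a)‖ := by
    rw [← Complex.norm_conj, ← hφ.map_star, star_mul, star_star]
  rw [hd, Complex.zero_re, zero_mul, norm_symm] at cauchy_schwarz
  exact norm_eq_zero.1 (mul_self_eq_zero.1 (cauchy_schwarz.antisymm (mul_self_nonneg _)))

theorem IsState.map_symmetry_le_one (hφ : IsState φ) {s : A} (hs : IsSymmetry s) : φ s ≤ 1 := by
  have h := hφ.1 (1 - s)
  rw [hs.star_sub_mul_sub, map_add, map_sub, hφ.2, ← two_mul] at h
  exact sub_nonneg.1 (le_of_mul_le_mul_left (by rwa [mul_zero]) (two_pos : (0 : ℂ) < 2))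

theorem IsState.map_mul_of_map_symmetry [StarModule ℂ A] (hφ : IsState φ) {s : A}
    (hs : IsSymmetry s) {u : ℤˣ} (hu : φ s = ((u : ℤ) : ℂ)) (a : A) :
    φ (s * a) = ((u : ℤ) : ℂ) * φ a := by
  have null : φ (star (1 - u • s) * (1 - u • s)) = 0 := by
    rw [(hs.units_smul u).star_sub_mul_sub, map_add, map_sub, hφ.2, Units.smul_def, map_zsmul, hu,
      zsmul_eq_mul, units_cast_mul_self, sub_self, add_zero]
  have h := hφ.map_star_mul_eq_zero null a
  rw [star_sub, star_one, (hs.units_smul u).isSelfAdjoint.star_eq, sub_mul, one_mul, map_sub,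
    Units.smul_def, smul_mul_assoc, map_zsmul, zsmul_eq_mul, sub_eq_zero] at h
  rw [h, ← mul_assoc, units_cast_mul_self, one_mul]

theorem IsState.map_mul_of_map_symmetry' [StarModule ℂ A] (hφ : IsState φ) {s : A}
    (hs : IsSymmetry s) {u : ℤˣ} (hu : φ s = ((u : ℤ) : ℂ)) (a : A) :
    φ (a * s) = ((u : ℤ) : ℂ) * φ a := by
  have h := congrArg (starRingEnd ℂ) (hφ.map_mul_of_map_symmetry hs hu (star a))
  rwa [RingHom.map_mul, ← hφ.map_star, ← hφ.map_star, star_mul, star_star,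
    hs.isSelfAdjoint.star_eq, map_intCast] at h

theorem IsState.map_eq_zero_of_anticommute [StarModule ℂ A] (hφ : IsState φ) {s : A}
    (hs : IsSymmetry s) {u : ℤˣ} (hu : φ s = ((u : ℤ) : ℂ)) {a : A} (ha : s * a = -(a * s)) :
    φ a = 0 := by
  have h := congrArg φ ha
  rw [map_neg, hφ.map_mul_of_map_symmetry hs hu, hφ.map_mul_of_map_symmetry' hs hu,
    self_eq_neg] at h
  exact (mul_eq_zero.1 h).resolve_left (Int.cast_ne_zero.2 u.ne_zero)

/-- The functional `a ↦ φ(b* a b) / φ(b* b)`. It is only meaningful when `φ(b* b) ≠ 0`. -/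
def compression [ContinuousMul A] (φ : A →L[ℂ] ℂ) (b : A) : A →L[ℂ] ℂ :=
  (φ (star b * b))⁻¹ • φ ∘L ⟨LinearMap.mulLeftRight ℂ (star b, b), by
    exact (continuous_const_mul (star b)).mul continuous_const⟩

theorem compression_apply [ContinuousMul A] (φ : A →L[ℂ] ℂ) (b a : A) :
    compression φ b a = (φ (star b * b))⁻¹ * φ (star b * a * b) := rfl

theorem IsState.compression [ContinuousMul A] (hφ : IsState φ) {b : A}
    (hb : φ (star b * b) ≠ 0) : IsState (compression φ b) := by
  refine ⟨fun a => ?_, ?_⟩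
  · have h : star b * (star a * a) * b = star (a * b) * (a * b) := by
      simp only [star_mul, mul_assoc]
    rw [compression_apply, h]
    exact mul_nonneg (inv_nonneg.2 (hφ.1 b)) (hφ.1 _)
  · rw [compression_apply, mul_one, inv_mul_cancel₀ hb]

theorem map_eq_mul_compression_of_central [ContinuousMul A] {p : A} (hp : IsStarProjection p)
    (hcomm : ∀ a, Commute p a) (h0 : φ p ≠ 0) (a : A) : φ (p * a) = φ p * compression φ p a := by
  rw [compression_apply, hp.isSelfAdjoint.star_eq, hp.isIdempotentElem.eq, mul_inv_cancel_left₀ h0,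
    mul_assoc, ← (hcomm a).eq, ← mul_assoc, hp.isIdempotentElem.eq]

theorem IsPureState.map_central_projection [ContinuousMul A] (hφ : IsPureState φ) {p : A}
    (hp : IsStarProjection p) (hcomm : ∀ a, Commute p a) : φ p = 0 ∨ φ p = 1 := by
  have hst : IsState φ := hφ.1
  have map_compl : φ (1 - p) = 1 - φ p := by rw [map_sub, hst.2]
  have star_mul_self {q : A} (hq : IsStarProjection q) : star q * q = q := by
    rw [hq.isSelfAdjoint.star_eq, hq.isIdempotentElem.eq]
  have nonneg {q : A} (hq : IsStarProjection q) : 0 ≤ φ q := star_mul_self hq ▸ hst.1 q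
  by_contra! h
  obtain ⟨h0, h1⟩ := h
  have h0' : φ (1 - p) ≠ 0 := map_compl ▸ sub_ne_zero.2 h1.symm
  obtain ⟨r, hr, hrp⟩ := RCLike.pos_iff_exists_ofReal.1 ((nonneg hp).lt_of_ne' h0)
  obtain ⟨t, ht, htp⟩ := RCLike.pos_iff_exists_ofReal.1 ((nonneg hp.one_sub).lt_of_ne' h0')
  have hcomm' (a : A) : Commute (1 - p) a := (Commute.one_left a).sub_left (hcomm a)
  have segment : φ ∈ openSegment ℝ (compression φ p) (compression φ (1 - p)) := by
    refine ⟨r, t, hr, ht, ?_, ContinuousLinearMap.ext fun a => ?_⟩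
    · have h : ((r + t : ℝ) : ℂ) = 1 := by
        rw [Complex.ofReal_add]
        exact (congrArg₂ (· + ·) hrp htp).trans (by rw [map_compl, add_sub_cancel])
      exact_mod_cast h
    · change (r : ℂ) * compression φ p a + (t : ℂ) * compression φ (1 - p) a = φ a
      rw [show (r : ℂ) = φ p from hrp, show (t : ℂ) = φ (1 - p) from htp,
        ← map_eq_mul_compression_of_central hp hcomm h0,
        ← map_eq_mul_compression_of_central hp.one_sub hcomm' h0', ← map_add, sub_mul, one_mul,
        add_sub_cancel]
  have extreme : compression φ p = φ := ((mem_extremePoints.1 hφ).2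
    _ (hst.compression (by rwa [star_mul_self hp]))
    _ (hst.compression (by rwa [star_mul_self hp.one_sub])) segment).1
  have h := map_eq_mul_compression_of_central (φ := φ) hp hcomm h0 p
  rw [extreme, hp.isIdempotentElem.eq, left_eq_mul₀ h0] at h
  exact h1 h

theorem IsPureState.exists_map_central_symmetry [StarModule ℂ A] [ContinuousMul A]
    (hφ : IsPureState φ) {s : A} (hs : IsSymmetry s) (hcomm : ∀ a, Commute s a) :
    ∃ u : ℤˣ, φ s = ((u : ℤ) : ℂ) := by
  have h := hφ.map_central_projection hs.isStarProjection
    fun a => ((Commute.one_left a).add_left (hcomm a)).smul_left _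
  rw [map_smul, map_add, hφ.1.2, smul_eq_mul] at h
  rcases h with h | h
  · exact ⟨-1, by push_cast; linear_combination 2 * h⟩
  · exact ⟨1, by push_cast; linear_combination 2 * h⟩

variable {ι : Type*} {S : ι → A} {f : ι → ℤˣ}

/-- `φ` is a state that assigns the sign `f i` to every `S i`. -/
structure IsSignState (S : ι → A) (f : ι → ℤˣ) (φ : A →L[ℂ] ℂ) : Prop where
  isState : IsState φ
  map_apply : ∀ i, φ (S i) = ((f i : ℤ) : ℂ)

theorem isExtreme_isSignState (hS : ∀ i, IsSymmetry (S i)) :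
    IsExtreme ℝ {φ : A →L[ℂ] ℂ | IsState φ} {φ | IsSignState S f φ} := by
  refine ⟨fun φ hφ => hφ.isState, fun φ₁ h₁ φ₂ h₂ φ hφ => ?_⟩
  rintro ⟨r, t, hr, ht, hrt, rfl⟩
  refine ⟨h₁, fun i => ?_⟩
  have le_one {ψ : A →L[ℂ] ℂ} (hψ : IsState ψ) : ((f i : ℤ) : ℂ) * ψ (S i) ≤ 1 := by
    have h := hψ.map_symmetry_le_one ((hS i).units_smul (f i))
    rwa [Units.smul_def, map_zsmul, zsmul_eq_mul] at h
  have average : ((f i : ℤ) : ℂ) * (r * φ₁ (S i) + t * φ₂ (S i)) = 1 := by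
    rw [show (r * φ₁ (S i) + t * φ₂ (S i) : ℂ) = ((f i : ℤ) : ℂ) from hφ.map_apply i,
      units_cast_mul_self]
  have deficits :
      r * (1 - ((f i : ℤ) : ℂ) * φ₁ (S i)) + t * (1 - ((f i : ℤ) : ℂ) * φ₂ (S i)) = 0 := by
    have h : (r + t : ℂ) = 1 := by exact_mod_cast hrt
    linear_combination h - average
  have weighted_nonneg {c : ℝ} (hc : 0 < c) {ψ : A →L[ℂ] ℂ} (hψ : IsState ψ) :
      0 ≤ c * (1 - ((f i : ℤ) : ℂ) * ψ (S i)) :=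
    mul_nonneg (Complex.zero_le_real.2 hc.le) (sub_nonneg.2 (le_one hψ))
  have h := ((add_eq_zero_iff_of_nonneg (weighted_nonneg hr h₁) (weighted_nonneg ht h₂)).1
    deficits).1
  have h := sub_eq_zero.1 ((mul_eq_zero.1 h).resolve_left (Complex.ofReal_ne_zero.2 hr.ne'))
  rw [← mul_one ((f i : ℤ) : ℂ), h, ← mul_assoc, units_cast_mul_self, one_mul]

theorem IsSignState.isPureState (hS : ∀ i, IsSymmetry (S i)) (hφ : IsSignState S f φ)
    (unique : ∀ ψ, IsSignState S f ψ → ψ = φ) : IsPureState φ := by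
  have singleton : {ψ | IsSignState S f ψ} = {φ} :=
    Set.eq_singleton_iff_unique_mem.2 ⟨hφ, unique⟩
  exact (singleton ▸ isExtreme_isSignState hS : IsExtreme ℝ _ {φ}).mem_extremePoints

theorem IsPureState.exists_isSignState [StarModule ℂ A] [ContinuousMul A] (hφ : IsPureState φ)
    (hS : ∀ i, IsSymmetry (S i)) (hcomm : ∀ i a, Commute (S i) a) :
    ∃ f, IsSignState S f φ := by
  choose f hf using fun i => hφ.exists_map_central_symmetry (hS i) (hcomm i)
  exact ⟨f, hφ.1, hf⟩

end States

section MultiplicativeDomain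

variable {A : Type*} [Ring A] [Algebra ℂ A] [TopologicalSpace A]

/-- The closed subalgebra of all `b` with `φ(b a) = ψ(b) φ(a)` and `ψ(b a) = ψ(b) ψ(a)` for all `a`:
the part of the multiplicative domains of two unital functionals on which they agree. -/
def jointMultiplicativeDomain (φ ψ : A →L[ℂ] ℂ) (hψ : ψ 1 = 1) :
    Subalgebra ℂ A where
  carrier := {b | ∀ a, φ (b * a) = ψ b * φ a ∧ ψ (b * a) = ψ b * ψ a}
  mul_mem' {b c} hb hc a := by
    simp only [mul_assoc, (hb _).1, (hb _).2, (hc _).1, (hc _).2, and_self]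
  add_mem' {b c} hb hc a := by
    simp only [add_mul, map_add, (hb _).1, (hb _).2, (hc _).1, (hc _).2, and_self]
  algebraMap_mem' c a := by
    simp only [Algebra.algebraMap_eq_smul_one, smul_mul_assoc, one_mul, map_smul, smul_eq_mul, hψ,
      mul_one, and_self]

theorem isClosed_jointMultiplicativeDomain [ContinuousMul A] {φ ψ : A →L[ℂ] ℂ}
    (hψ : ψ 1 = 1) : IsClosed (jointMultiplicativeDomain φ ψ hψ : Set A) := by
  have closed (χ : A →L[ℂ] ℂ) (a : A) : IsClosed {b | χ (b * a) = ψ b * χ a} :=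
    isClosed_eq (by fun_prop) (by fun_prop)
  change IsClosed {b | ∀ a, φ (b * a) = ψ b * φ a ∧ ψ (b * a) = ψ b * ψ a}
  simp only [Set.ofPred_forall, Set.ofPred_and]
  exact isClosed_iInter fun a => (closed φ a).inter (closed ψ a)

end MultiplicativeDomain

section Restriction

variable {A : Type*} [Ring A] [StarRing A] [Algebra ℂ A] [StarModule ℂ A] [TopologicalSpace A]
  {φ : A →L[ℂ] ℂ}

instance continuousStar_starSubalgebra [ContinuousStar A] (B : StarSubalgebra ℂ A) :
    ContinuousStar B :=
  ⟨continuous_subtype_val.star.subtype_mk _⟩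

/-- The restriction of a functional to a ⋆-subalgebra. -/
def restriction (B : StarSubalgebra ℂ A) (φ : A →L[ℂ] ℂ) : B →L[ℂ] ℂ :=
  φ ∘L B.toSubalgebra.toSubmodule.subtypeL

theorem IsState.restriction (hφ : IsState φ) (B : StarSubalgebra ℂ A) :
    IsState (restriction B φ) :=
  ⟨fun b => hφ.1 b, hφ.2⟩

end Restriction

section Generated

variable {A : Type*} [Ring A] [StarRing A] [Algebra ℂ A] [StarModule ℂ A] [TopologicalSpace A]
  [IsTopologicalSemiring A] [ContinuousStar A] {ι : Type*} {S : ι → A} {f : ι → ℤˣ}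
  {φ ψ : A →L[ℂ] ℂ}

/-- The C⋆-algebra `C⋆{S i}` generated by a family. -/
def generated (S : ι → A) : StarSubalgebra ℂ A :=
  (StarAlgebra.adjoin ℂ (Set.range S)).topologicalClosure

theorem isClosed_generated (S : ι → A) : IsClosed (generated S : Set A) :=
  StarSubalgebra.isClosed_topologicalClosure _

theorem mem_generated (S : ι → A) (i : ι) : S i ∈ generated S :=
  StarSubalgebra.le_topologicalClosure _ (StarAlgebra.subset_adjoin ℂ _ ⟨i, rfl⟩)

theorem generated_toSubalgebra_le (hS : ∀ i, IsSelfAdjoint (S i)) {B : Subalgebra ℂ A}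
    (hB : IsClosed (B : Set A)) (hmem : ∀ i, S i ∈ B) : (generated S).toSubalgebra ≤ B := by
  have star_range : star (Set.range S) = Set.range S := by
    rw [← Set.image_star, ← Set.range_comp]
    exact congrArg Set.range (funext fun i => (hS i).star_eq)
  refine Subalgebra.topologicalClosure_minimal ?_ hB
  rw [StarAlgebra.adjoin_toSubalgebra, star_range, Set.union_self]
  exact Algebra.adjoin_le (Set.range_subset_iff.2 hmem)

theorem commute_of_mem_generated [T2Space A] (hS : ∀ i, IsSelfAdjoint (S i)) {a b : A}
    (ha : ∀ i, Commute a (S i)) (hb : b ∈ generated S) : Commute a b :=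
  generated_toSubalgebra_le hS (B := Subalgebra.centralizer ℂ {a}) (Set.isClosed_centralizer {a})
    (fun i _ h => h ▸ ha i) hb a rfl

/-- The generators of `C⋆{S i}`, as elements of that algebra. -/
def generator (S : ι → A) (i : ι) : generated S := ⟨S i, mem_generated S i⟩

theorem generated_generator (S : ι → A) : generated (generator S) = ⊤ := by
  have closed : IsClosed ((generated (generator S)).map (generated S).subtype : Set A) :=
    (isClosed_generated S).isClosedMap_subtype_val _ (isClosed_generated (generator S))
  have le : generated S ≤ (generated (generator S)).map (generated S).subtype :=
    StarSubalgebra.topologicalClosure_minimal (StarAlgebra.adjoin_le <| Set.range_subset_iff.2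
      fun i => ⟨_, mem_generated (generator S) i, rfl⟩) closed
  refine StarSubalgebra.eq_top_iff.2 fun b => ?_
  obtain ⟨c, hc, hcb⟩ := le b.2
  exact (Subtype.ext hcb : c = b) ▸ hc

theorem IsSignState.generated_le_jointMultiplicativeDomain (hS : ∀ i, IsSymmetry (S i))
    (hφ : IsSignState S f φ) (hψ : IsSignState S f ψ) :
    (generated S).toSubalgebra ≤
      jointMultiplicativeDomain φ ψ hψ.isState.2 :=
  generated_toSubalgebra_le (fun i => (hS i).isSelfAdjoint)
    (isClosed_jointMultiplicativeDomain _) fun i a => by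
      rw [hψ.map_apply, hφ.isState.map_mul_of_map_symmetry (hS i) (hφ.map_apply i),
        hψ.isState.map_mul_of_map_symmetry (hS i) (hψ.map_apply i)]
      exact ⟨rfl, rfl⟩

theorem IsSignState.eqOn_generated (hS : ∀ i, IsSymmetry (S i)) (hφ : IsSignState S f φ)
    (hψ : IsSignState S f ψ) : Set.EqOn φ ψ (generated S) := fun b hb => by
  simpa only [mul_one, hφ.isState.2] using
    (hφ.generated_le_jointMultiplicativeDomain hS hψ hb 1).1

theorem IsSignState.map_mul (hS : ∀ i, IsSymmetry (S i)) (hφ : IsSignState S f φ) {b : A}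
    (hb : b ∈ generated S) (a : A) : φ (b * a) = φ b * φ a :=
  (hφ.generated_le_jointMultiplicativeDomain hS hφ hb a).1

theorem isPureState_iff_exists_isSignState [T2Space A] (hS : ∀ i, IsSymmetry (S i))
    (hcomm : ∀ i j, Commute (S i) (S j)) (hgen : generated S = ⊤) :
    IsPureState φ ↔ ∃ f, IsSignState S f φ := by
  have mem (a : A) : a ∈ generated S := hgen ▸ StarSubalgebra.mem_top
  refine ⟨fun h => h.exists_isSignState hS fun i a =>
    commute_of_mem_generated (fun i => (hS i).isSelfAdjoint) (hcomm i) (mem a), ?_⟩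
  rintro ⟨f, hf⟩
  exact hf.isPureState hS fun ψ hψ =>
    ContinuousLinearMap.ext fun a => hψ.eqOn_generated hS hf (mem a)

end Generated

theorem isState_of_map_mul {A : Type*} [CStarAlgebra A] {ω : A →L[ℂ] ℂ} (map_one : ω 1 = 1)
    (map_mul : ∀ a b, ω (a * b) = ω a * ω b) : IsState ω := by
  let χ : A →ₐ[ℂ] ℂ := AlgHom.ofLinearMap (ω : A →ₗ[ℂ] ℂ) map_one map_mul
  have : StarHomClass (A →ₐ[ℂ] ℂ) A ℂ := AlgHomClass.instStarHomClass
  refine ⟨fun a => ?_, map_one⟩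
  rw [map_mul, show ω (star a) = star (ω a) from map_star χ a]
  exact star_mul_self_nonneg _

section StabilizerSystem

variable {A : Type*} [CStarAlgebra A] {ι : Type*} {S : ι → A} {P : Set A} {f : ι → ℤˣ}

/-- The average `(a + s a s) / 2` of `a` over conjugation by a symmetry `s`. -/
def conjAverage (s : A) : A →ₗ[ℂ] A :=
  (2⁻¹ : ℂ) • (LinearMap.id + LinearMap.mulLeftRight ℂ (s, s))

theorem conjAverage_apply (s a : A) : conjAverage s a = (2⁻¹ : ℂ) • (a + s * a * s) := rfl

theorem norm_conjAverage_le {s : A} (hs : IsSymmetry s) (a : A) : ‖conjAverage s a‖ ≤ ‖a‖ := by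
  have norm_conj : ‖s * a * s‖ = ‖a‖ := by
    rw [CStarRing.norm_mul_mem_unitary _ hs.mem_unitary,
      CStarRing.norm_mem_unitary_mul _ hs.mem_unitary]
  have h := norm_add_le a (s * a * s)
  rw [norm_conj] at h
  rw [conjAverage_apply, norm_smul, norm_inv, Complex.norm_ofNat]
  linarith

theorem conjAverage_of_commute {s : A} (hs : IsSymmetry s) {a : A} (ha : Commute s a) :
    conjAverage s a = a := by
  rw [conjAverage_apply, ha.eq, mul_assoc, hs.mul_self, mul_one]
  module

theorem conjAverage_of_anticommute {s : A} (hs : IsSymmetry s) {a : A}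
    (ha : s * a = -(a * s)) : conjAverage s a = 0 := by
  rw [conjAverage_apply, ha, neg_mul, mul_assoc, hs.mul_self, mul_one, add_neg_cancel, smul_zero]

theorem conj_mem_generated (hS : ∀ i, IsSelfAdjoint (S i)) {u : A} (hu : u ∈ unitary A)
    (hconj : ∀ i, u * S i * star u ∈ generated S) {b : A} (hb : b ∈ generated S) :
    u * b * star u ∈ generated S :=
  generated_toSubalgebra_le hS (B := (generated S).toSubalgebra.comap
      (Unitary.conjStarAlgAut ℂ A ⟨u, hu⟩ : A →ₐ[ℂ] A))
    ((isClosed_generated S).preimage (by fun_prop : Continuous fun b => u * b * star u)) hconj hb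

theorem isSymmetry_generator (hS : ∀ i, IsSymmetry (S i)) (i : ι) : IsSymmetry (generator S i) :=
  ⟨Subtype.ext (hS i).isSelfAdjoint, Subtype.ext (hS i).mul_self⟩

theorem IsSignState.restriction {φ : A →L[ℂ] ℂ} (hφ : IsSignState S f φ) :
    IsSignState (generator S) f (restriction (generated S) φ) :=
  ⟨hφ.isState.restriction _, hφ.map_apply⟩

/-- Commuting symmetries `S i` together with a set `P` of unitaries spanning a dense subspace, for
instance the Pauli strings: each element of `P` commutes or anticommutes with each `S i`, and the
elements that commute with all of them belong to `C⋆{S i}`. -/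
structure IsStabilizerSystem (S : ι → A) (P : Set A) : Prop where
  isSymmetry : ∀ i, IsSymmetry (S i)
  commute : ∀ i j, Commute (S i) (S j)
  dense_span : Dense (Submodule.span ℂ P : Set A)
  subset_unitary : P ⊆ unitary A
  commute_or_anticommute : ∀ p ∈ P, ∀ i, Commute (S i) p ∨ S i * p = -(p * S i)
  mem_generated : ∀ p ∈ P, (∀ i, Commute (S i) p) → p ∈ generated S

namespace IsStabilizerSystem

theorem mem_generated_or_anticommute (h : IsStabilizerSystem S P) {p : A} (hp : p ∈ P) :
    p ∈ generated S ∨ ∃ i, S i * p = -(p * S i) := by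
  by_cases hcomm : ∀ i, Commute (S i) p
  · exact .inl (h.mem_generated p hp hcomm)
  · obtain ⟨i, hi⟩ := not_forall.1 hcomm
    exact .inr ⟨i, (h.commute_or_anticommute p hp i).resolve_left hi⟩

theorem norm_le_norm_add_sum (h : IsStabilizerSystem S P) {x : A} (hx : ∀ i, Commute (S i) x)
    (J : Finset A) (hJ : ∀ p ∈ J, p ∈ P ∧ ∃ i, S i * p = -(p * S i)) (α : A → ℂ) :
    ‖x‖ ≤ ‖x + ∑ p ∈ J, α p • p‖ := by
  classical
  induction J using Finset.induction_on generalizing α with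
  | empty => rw [Finset.sum_empty, add_zero]
  | insert p J hpJ ih =>
    obtain ⟨⟨-, i, hi⟩, hJ⟩ := Finset.forall_mem_insert .. |>.1 hJ
    let β : A → ℂ := fun q => if Commute (S i) q then α q else 0
    have average_term {q : A} (hq : q ∈ J) : conjAverage (S i) (α q • q) = β q • q := by
      rw [map_smul]
      by_cases hc : Commute (S i) q
      · rw [conjAverage_of_commute (h.isSymmetry i) hc, show β q = α q from if_pos hc]
      · rw [conjAverage_of_anticommute (h.isSymmetry i)
          ((h.commute_or_anticommute q (hJ q hq).1 i).resolve_left hc), smul_zero,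
          show β q = 0 from if_neg hc, zero_smul]
    calc ‖x‖ ≤ ‖x + ∑ q ∈ J, β q • q‖ := ih hJ β
      _ = ‖conjAverage (S i) (x + ∑ q ∈ insert p J, α q • q)‖ := by
        rw [Finset.sum_insert hpJ, map_add, map_add, map_sum, map_smul,
          conjAverage_of_commute (h.isSymmetry i) (hx i),
          conjAverage_of_anticommute (h.isSymmetry i) hi, smul_zero, zero_add,
          Finset.sum_congr rfl fun q hq => average_term hq]
      _ ≤ ‖x + ∑ q ∈ insert p J, α q • q‖ := norm_conjAverage_le (h.isSymmetry i) _

theorem mem_generated_of_commute (h : IsStabilizerSystem S P) {a : A}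
    (ha : ∀ i, Commute (S i) a) : a ∈ generated S := by
  refine (isClosed_generated S).closure_subset (Metric.mem_closure_iff.2 fun ε hε => ?_)
  obtain ⟨b, hb, hab⟩ := h.dense_span.exists_dist_lt a hε
  have split : P ⊆ generated S ∪ {p | p ∈ P ∧ ∃ i, S i * p = -(p * S i)} := fun p hp =>
    (h.mem_generated_or_anticommute hp).imp_right fun hi => ⟨hp, hi⟩
  have hb := Submodule.span_mono split hb
  rw [Submodule.span_union] at hb
  obtain ⟨c, hc, d, hd, rfl⟩ := Submodule.mem_sup.1 hb
  have hc : c ∈ generated S :=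
    Submodule.span_le (p := (generated S).toSubalgebra.toSubmodule).2 le_rfl hc
  have hx (i : ι) : Commute (S i) (a - c) := (ha i).sub_right <|
    commute_of_mem_generated (fun i => (h.isSymmetry i).isSelfAdjoint) (h.commute i) hc
  obtain ⟨α, J, hJ, -, hα⟩ :=
    Submodule.mem_span_iff_exists_finset_subset.1 (neg_mem hd)
  have key := h.norm_le_norm_add_sum hx J (fun p hp => hJ hp) α
  rw [hα, ← sub_eq_add_neg, sub_sub, ← dist_eq_norm, ← dist_eq_norm] at key
  exact ⟨c, hc, key.trans_lt hab⟩

theorem isMasa (h : IsStabilizerSystem S P) : IsMasa (generated S) := by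
  refine Set.Subset.antisymm (fun a ha => h.mem_generated_of_commute fun i =>
    ha _ (CStarDiagonal.mem_generated S i)) fun a ha b hb => ?_
  have commute_generator (i : ι) : Commute b (S i) := (commute_of_mem_generated
    (fun j => (h.isSymmetry j).isSelfAdjoint) (h.commute i) hb).symm
  exact commute_of_mem_generated (fun i => (h.isSymmetry i).isSelfAdjoint) commute_generator ha

theorem isNormalizer (h : IsStabilizerSystem S P) {p : A} (hp : p ∈ P) :
    IsNormalizer (generated S) p := by
  have hu := h.subset_unitary hp
  have hself (i : ι) : IsSelfAdjoint (S i) := (h.isSymmetry i).isSelfAdjoint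
  refine fun b hb => ⟨conj_mem_generated hself hu (fun i => ?_) hb, ?_⟩
  · rcases h.commute_or_anticommute p hp i with hi | hi
    · rw [← hi.eq, mul_assoc, Unitary.mul_star_self_of_mem hu, mul_one]
      exact CStarDiagonal.mem_generated S i
    · rw [← neg_eq_iff_eq_neg.2 hi, neg_mul, mul_assoc, Unitary.mul_star_self_of_mem hu, mul_one]
      exact neg_mem (CStarDiagonal.mem_generated S i)
  · rw [← star_star p, star_star (star p)]
    refine conj_mem_generated hself (Unitary.star_mem hu) (fun i => ?_) hb
    rw [star_star, mul_assoc]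
    rcases h.commute_or_anticommute p hp i with hi | hi
    · rw [hi.eq, ← mul_assoc, Unitary.star_mul_self_of_mem hu, one_mul]
      exact CStarDiagonal.mem_generated S i
    · rw [hi, mul_neg, ← mul_assoc, Unitary.star_mul_self_of_mem hu, one_mul]
      exact neg_mem (CStarDiagonal.mem_generated S i)

theorem isRegular (h : IsStabilizerSystem S P) : IsRegular (generated S) := by
  let N := StarAlgebra.adjoin ℂ {a : A | IsNormalizer (generated S) a}
  have span_le : (Submodule.span ℂ P : Set A) ⊆ N :=
    Submodule.span_le (p := N.toSubalgebra.toSubmodule).2 fun p hp =>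
      StarAlgebra.subset_adjoin ℂ _ (h.isNormalizer hp)
  exact StarSubalgebra.eq_top_iff.2 (h.dense_span.mono span_le)

theorem signState_unique (h : IsStabilizerSystem S P) {φ ψ : A →L[ℂ] ℂ}
    (hφ : IsSignState S f φ) (hψ : IsSignState S f ψ) : φ = ψ := by
  refine ContinuousLinearMap.ext_on h.dense_span fun p hp => ?_
  rcases h.mem_generated_or_anticommute hp with hgen | ⟨i, hi⟩
  · exact hφ.eqOn_generated h.isSymmetry hψ hgen
  · rw [hφ.isState.map_eq_zero_of_anticommute (h.isSymmetry i) (hφ.map_apply i) hi,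
      hψ.isState.map_eq_zero_of_anticommute (h.isSymmetry i) (hψ.map_apply i) hi]

theorem isPureState_generated_iff (h : IsStabilizerSystem S P) {ω : generated S →L[ℂ] ℂ} :
    IsPureState ω ↔ ∃ f, IsSignState (generator S) f ω :=
  isPureState_iff_exists_isSignState (isSymmetry_generator h.isSymmetry)
    (fun i j => Subtype.ext (h.commute i j)) (generated_generator S)

theorem isSignState_generator_iff (h : IsStabilizerSystem S P) {ω : generated S →L[ℂ] ℂ} :
    IsSignState (generator S) f ω ↔
      ω 1 = 1 ∧ (∀ a b, ω (a * b) = ω a * ω b) ∧ ∀ i, ω (generator S i) = ((f i : ℤ) : ℂ) := by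
  have : IsClosed (generated S : Set A) := isClosed_generated S
  refine ⟨fun hω => ⟨hω.isState.2, fun a b => ?_, hω.map_apply⟩,
    fun ⟨map_one, map_mul, map_generator⟩ => ⟨isState_of_map_mul map_one map_mul, map_generator⟩⟩
  exact hω.map_mul (isSymmetry_generator h.isSymmetry)
    (generated_generator S ▸ StarSubalgebra.mem_top) b

theorem existsUnique_isSignState_generator (h : IsStabilizerSystem S P) {φ : A →L[ℂ] ℂ}
    (hφ : IsSignState S f φ) :
    ∃! ω : generated S →L[ℂ] ℂ, IsSignState (generator S) f ω :=
  ⟨restriction (generated S) φ, hφ.restriction, fun _ hω => ContinuousLinearMap.ext fun _ =>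
    hω.eqOn_generated (isSymmetry_generator h.isSymmetry) hφ.restriction
      (generated_generator S ▸ StarSubalgebra.mem_top)⟩

theorem exists_pure_extension (h : IsStabilizerSystem S P) {φ : A →L[ℂ] ℂ}
    (hφ : IsSignState S f φ) {ω : generated S →L[ℂ] ℂ} (hω : IsSignState (generator S) f ω) :
    IsPureState φ ∧ Extends ω φ ∧ ∀ η, IsState η → Extends ω η → η = φ := by
  refine ⟨hφ.isPureState h.isSymmetry fun ψ hψ => h.signState_unique hψ hφ, ?_, fun η hη hext =>
    h.signState_unique ⟨hη, fun i => (hext (generator S i)).trans (hω.map_apply i)⟩ hφ⟩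
  exact fun b => hφ.restriction.eqOn_generated (isSymmetry_generator h.isSymmetry) hω
    (generated_generator S ▸ StarSubalgebra.mem_top)

theorem isCStarDiagonal (h : IsStabilizerSystem S P) (hex : ∀ f, ∃ φ, IsSignState S f φ) :
    IsCStarDiagonal (generated S) where
  isClosed := isClosed_generated S
  isMasa := h.isMasa
  isRegular := h.isRegular
  hasUniqueExtension ω hω := by
    obtain ⟨f, hf⟩ := h.isPureState_generated_iff.1 hω
    obtain ⟨φ, hφ⟩ := hex f
    obtain ⟨pure, ext, unique⟩ := h.exists_pure_extension hφ hf
    exact ⟨φ, ⟨pure, ext⟩, fun η hη => unique η hη.1.1 hη.2⟩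

end IsStabilizerSystem

end StabilizerSystem

section StateSpace

variable {A : Type*} [CStarAlgebra A] {φ : A →L[ℂ] ℂ}

theorem IsState.map_star_mul_self_le (hφ : IsState φ) (a : A) : φ (star a * a) ≤ (‖a‖ ^ 2 : ℝ) := by
  let _ := CStarAlgebra.spectralOrder A
  have := CStarAlgebra.spectralOrderedRing A
  obtain ⟨c, hc⟩ := CStarAlgebra.nonneg_iff_eq_star_mul_self.1
    (sub_nonneg.2 (CStarAlgebra.star_mul_le_algebraMap_norm_sq (a := a)))
  have h := hφ.1 c
  rwa [← hc, map_sub, sub_nonneg, IsScalarTower.algebraMap_apply ℝ ℂ A,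
    Algebra.algebraMap_eq_smul_one, map_smul, hφ.2, smul_eq_mul, mul_one] at h

theorem IsState.norm_le_one (hφ : IsState φ) : ‖φ‖ ≤ 1 := by
  refine φ.opNorm_le_bound zero_le_one fun a => ?_
  have cauchy_schwarz :=
    @InnerProductSpace.Core.inner_mul_inner_self_le ℂ A _ _ _ hφ.preInnerProductCore 1 a
  change ‖φ (star 1 * a)‖ * ‖φ (star a * 1)‖ ≤
    (φ (star 1 * 1)).re * (φ (star a * a)).re at cauchy_schwarz
  rw [star_one, one_mul, one_mul, mul_one, hφ.2, hφ.map_star, Complex.norm_conj, Complex.one_re,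
    one_mul, ← sq] at cauchy_schwarz
  rw [one_mul]
  exact le_of_sq_le_sq (cauchy_schwarz.trans (Complex.le_def.1 (hφ.map_star_mul_self_le a)).1)
    (norm_nonneg a)

theorem isCompact_setOf_isState :
    IsCompact {φ : WeakDual ℂ A | IsState (WeakDual.toStrongDual φ)} := by
  refine (WeakDual.isCompact_closedBall (0 : StrongDual ℂ A) 1).of_isClosed_subset ?_
    fun φ hφ => mem_closedBall_zero_iff.2 hφ.norm_le_one
  have eval_continuous (a : A) : Continuous fun φ : WeakDual ℂ A => WeakDual.toStrongDual φ a :=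
    WeakDual.eval_continuous a
  simp only [IsState, Set.ofPred_and, Set.ofPred_forall]
  exact (isClosed_iInter fun a => isClosed_le continuous_const (eval_continuous _)).inter
    (isClosed_eq (eval_continuous _) continuous_const)

variable {ι : Type*} {S : ι → A} {f : ι → ℤˣ}

/-- Each sign of the family can be reversed independently of any finite number of others: some
unitary anticommutes with `S i` and commutes with the prescribed `S j`. -/
def SignsFlippable (S : ι → A) : Prop :=
  ∀ (F : Finset ι), ∀ i ∉ F, ∃ u ∈ unitary A, S i * u = -(u * S i) ∧ ∀ j ∈ F, Commute (S j) u

theorem compression_eq_of_commute (hφ : IsState φ) {s b : A} (hs : IsSymmetry s) {u : ℤˣ}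
    (hu : φ s = ((u : ℤ) : ℂ)) (hcomm : Commute s b) (hb : φ (star b * b) ≠ 0) :
    compression φ b s = ((u : ℤ) : ℂ) := by
  have h : star b * s * b = star b * b * s := by rw [mul_assoc, hcomm.eq, mul_assoc]
  rw [compression_apply, h, hφ.map_mul_of_map_symmetry' hs hu, mul_left_comm, inv_mul_cancel₀ hb,
    mul_one]

theorem compression_eq_of_anticommute {s u : A} (hu : u ∈ unitary A) (hφ : φ 1 = 1)
    (hanti : s * u = -(u * s)) : compression φ u s = -φ s := by
  have h : star u * s * u = -s := by
    rw [mul_assoc, hanti, mul_neg, ← mul_assoc, Unitary.star_mul_self_of_mem hu, one_mul]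
  rw [compression_apply, h, Unitary.star_mul_self_of_mem hu, hφ, inv_one, one_mul, map_neg]

theorem compression_eq_of_mul_eq {s b : A} {c : ℂ} (hs : s * b = c • b)
    (hb : φ (star b * b) ≠ 0) : compression φ b s = c := by
  rw [compression_apply, mul_assoc, hs, mul_smul_comm, map_smul, smul_eq_mul, mul_left_comm,
    inv_mul_cancel₀ hb, mul_one]

theorem exists_state_map_insert [DecidableEq ι] (hS : ∀ i, IsSymmetry (S i))
    (hcomm : ∀ i j, Commute (S i) (S j)) (hflip : SignsFlippable S) {F : Finset ι} {i : ι}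
    (hi : i ∉ F) (hφ : IsState φ) (hF : ∀ j ∈ F, φ (S j) = ((f j : ℤ) : ℂ)) :
    ∃ ψ : A →L[ℂ] ℂ, IsState ψ ∧ ∀ j ∈ insert i F, ψ (S j) = ((f j : ℤ) : ℂ) := by
  -- Compress by the spectral projection of `S i` if that is possible. Otherwise `φ (S i) = -f i`,
  -- and a flip of the sign of `S i` repairs this.
  let c : ℂ := ((f i : ℤ) : ℂ)
  let b : A := 1 + c • S i
  have hcc : c * c = 1 := units_cast_mul_self (f i)
  have commute_b (j : ι) : Commute (S j) b :=
    (Commute.one_right _).add_right ((hcomm j i).smul_right c)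
  have mul_b : S i * b = c • b := by
    simp only [b, mul_add, mul_one, mul_smul_comm, (hS i).mul_self, smul_add, smul_smul, hcc,
      one_smul, add_comm]
  have star_mul_self : star b * b = (2 : ℂ) • b := by
    have hb : star b = b := by
      simp only [b, c, star_add, star_one, star_smul, star_intCast, (hS i).isSelfAdjoint.star_eq]
    rw [hb, show b * b = 1 * b + c • S i * b from add_mul _ _ _, one_mul, smul_mul_assoc, mul_b,
      smul_smul, hcc, one_smul, two_smul]
  by_cases hb : φ (star b * b) = 0
  · obtain ⟨u, hu, hanti, hcommu⟩ := hflip F i hi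
    have hne : φ (star u * u) ≠ 0 := by
      rw [Unitary.star_mul_self_of_mem hu, hφ.2]
      exact one_ne_zero
    refine ⟨compression φ u, hφ.compression hne, (Finset.forall_mem_insert _ _ _).2
      ⟨?_, fun j hj => compression_eq_of_commute hφ (hS j) (hF j hj) (hcommu j hj) hne⟩⟩
    rw [compression_eq_of_anticommute hu hφ.2 hanti]
    rw [star_mul_self, map_smul, map_add, map_smul, hφ.2, smul_eq_mul, smul_eq_mul] at hb
    change -φ (S i) = c
    linear_combination (-c / 2) * hb + φ (S i) * hcc
  · exact ⟨compression φ b, hφ.compression hb, (Finset.forall_mem_insert _ _ _).2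
      ⟨compression_eq_of_mul_eq mul_b hb, fun j hj =>
        compression_eq_of_commute hφ (hS j) (hF j hj) (commute_b j) hb⟩⟩

theorem exists_isSignState (hex : ∃ φ : A →L[ℂ] ℂ, IsState φ) (hS : ∀ i, IsSymmetry (S i))
    (hcomm : ∀ i j, Commute (S i) (S j)) (hflip : SignsFlippable S) (f : ι → ℤˣ) :
    ∃ φ, IsSignState S f φ := by
  classical
  have finite (F : Finset ι) :
      ∃ φ : A →L[ℂ] ℂ, IsState φ ∧ ∀ i ∈ F, φ (S i) = ((f i : ℤ) : ℂ) := by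
    induction F using Finset.induction_on with
    | empty => simpa using hex
    | insert i F hi ih =>
      obtain ⟨φ, hφ, hF⟩ := ih
      exact exists_state_map_insert hS hcomm hflip hi hφ hF
  obtain ⟨φ, hφ, hf⟩ := isCompact_setOf_isState.inter_iInter_nonempty
    (fun i => {φ : WeakDual ℂ A | φ (S i) = ((f i : ℤ) : ℂ)})
    (fun i => isClosed_eq (WeakDual.eval_continuous _) continuous_const) fun F => by
      obtain ⟨φ, hφ, hF⟩ := finite F
      exact ⟨StrongDual.toWeakDual φ, hφ, Set.mem_iInter₂.2 hF⟩
  exact ⟨WeakDual.toStrongDual φ, hφ, Set.mem_iInter.1 hf⟩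

end StateSpace

theorem exists_isState (H : Type*) [NormedAddCommGroup H] [InnerProductSpace ℂ H]
    [CompleteSpace H] [Nontrivial H] : ∃ φ : (H →L[ℂ] H) →L[ℂ] ℂ, IsState φ := by
  obtain ⟨ψ, hψ⟩ := exists_norm_eq H zero_le_one
  refine ⟨(innerSL ℂ ψ).comp (ContinuousLinearMap.apply ℂ H ψ), fun a => ?_, ?_⟩
  · change 0 ≤ ⟪ψ, (star a * a) ψ⟫_ℂ
    rw [ContinuousLinearMap.star_eq_adjoint, mul_apply_eq_comp,
      ContinuousLinearMap.adjoint_inner_right, inner_self_eq_norm_sq_to_K,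
      ← RCLike.ofReal_pow]
    exact RCLike.ofReal_nonneg.2 (sq_nonneg ‖a ψ‖)
  · exact inner_self_eq_one_of_norm_eq_one hψ

end CStarDiagonal

namespace SpinSystem

open Module CStarDiagonal

theorem zmod_two_eq_zero_or_one : ∀ a : ZMod 2, a = 0 ∨ a = 1 := by
  decide

/-- The nontrivial character `a ↦ (-1)^a` of `ZMod 2`. -/
def sign : AddChar (ZMod 2) ℂ := AddChar.zmodChar 2 (ζ := -1) (by norm_num)

theorem sign_one : sign 1 = -1 := pow_one _

theorem sign_mul_self (a : ZMod 2) : sign a * sign a = 1 := by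
  rw [← AddChar.map_add_eq_mul, CharTwo.add_self_eq_zero, AddChar.map_zero_eq_one]

theorem star_sign (a : ZMod 2) : star (sign a) = sign a := by
  simp only [sign, AddChar.zmodChar_apply, star_pow, star_neg, star_one]

theorem sign_injective : Function.Injective sign := by
  intro a b h
  rw [← sub_eq_zero, CharTwo.sub_eq_add]
  have h : sign (a + b) = 1 := by rw [AddChar.map_add_eq_mul, h, sign_mul_self]
  refine (zmod_two_eq_zero_or_one _).resolve_right fun h1 => ?_
  rw [h1, sign_one] at h
  exact absurd h (by norm_num)

theorem span_range_walsh (ι : Type*) [Fintype ι] :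
    Submodule.span ℂ (Set.range fun (z s : ι → ZMod 2) => sign (z ⬝ᵥ s)) = ⊤ := by
  classical
  let χ (z : ι → ZMod 2) : AddChar (ι → ZMod 2) ℂ :=
    sign.compAddMonoidHom (dotProductBilin (ZMod 2) (ZMod 2) z).toAddMonoidHom
  have injective : Function.Injective χ := fun z z' h => dotProduct_eq z z' fun s =>
    sign_injective (DFunLike.congr_fun h s)
  have independent : LinearIndependent ℂ fun (z s : ι → ZMod 2) => sign (z ⬝ᵥ s) :=
    (AddChar.linearIndependent (ι → ZMod 2) ℂ).comp χ injective
  exact independent.span_eq_top_of_card_eq_finrank' (finrank_fintype_fun_eq_card ℂ).symm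

/-- The pairing `∑ z e * s e` between finitely supported and arbitrary families of bits. -/
def pairing {E : Type*} : (E →₀ ZMod 2) →ₗ[ZMod 2] (E → ZMod 2) →ₗ[ZMod 2] ZMod 2 :=
  (Finsupp.bilinearCombination (ZMod 2) (ZMod 2)).flip

section Pairing

variable {E : Type*}

theorem pairing_single (e : E) (s : E → ZMod 2) : pairing (Finsupp.single e 1) s = s e := by
  simp [pairing]

theorem pairing_eq_sum {Λ : Finset E} {z : E →₀ ZMod 2} (hz : z.support ⊆ Λ) (s : E → ZMod 2) :
    pairing z s = ∑ e ∈ Λ, z e * s e :=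
  Finsupp.sum_of_support_subset z hz _ fun _ _ => zero_smul _ _

theorem pairing_comm (z x : E →₀ ZMod 2) : pairing z x = pairing x z := by
  classical
  rw [pairing_eq_sum Finset.subset_union_left, pairing_eq_sum Finset.subset_union_right]
  exact Finset.sum_congr rfl fun _ _ => mul_comm _ _

end Pairing

/-- The pair `(x, z)` labels the Pauli string `Z^z X^x`, see `pauliString`. -/
abbrev PauliVector (E : Type*) : Type _ := (E →₀ ZMod 2) × (E →₀ ZMod 2)

/-- The symplectic form on `PauliVector E`, which governs the commutation of Pauli strings. -/
def symplecticForm {E : Type*} (p q : PauliVector E) : ZMod 2 :=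
  pairing p.2 q.1 + pairing q.2 p.1

variable {E : Type}

/-- The value of a wave function at a configuration whose bits are read in `ZMod 2`. -/
def amplitude (ψ : ConfigSpace E) (s : E → ZMod 2) : ℂ := ψ s

/-- The Pauli matrix `Z^z X^x` of the sites in `Λ`. -/
def pauliMatrix {Λ : Finset E} (x z : Λ → ZMod 2) : LocalMatrix Λ :=
  Matrix.of fun s t : Λ → ZMod 2 => if t = s + x then sign (z ⬝ᵥ s) else 0

theorem star_pauliMatrix {Λ : Finset E} (x z : Λ → ZMod 2) :
    star (pauliMatrix x z) = sign (z ⬝ᵥ x) • pauliMatrix x z := by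
  refine Matrix.ext fun (s t : Λ → ZMod 2) => ?_
  change star (if s = t + x then sign (z ⬝ᵥ t) else 0) =
    sign (z ⬝ᵥ x) * (if t = s + x then sign (z ⬝ᵥ s) else 0)
  by_cases h : t = s + x
  · have h' : s = t + x := by rw [h, add_assoc, ZModModule.add_self, add_zero]
    rw [if_pos h, if_pos h', star_sign, h, dotProduct_add, add_comm, AddChar.map_add_eq_mul]
  · have h' : ¬ s = t + x := fun h' => h (by rw [h', add_assoc, ZModModule.add_self, add_zero])
    rw [if_neg h, if_neg h', star_zero, mul_zero]

theorem span_range_pauliMatrix (Λ : Finset E) :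
    Submodule.span ℂ (Set.range fun p : (Λ → ZMod 2) × (Λ → ZMod 2) => pauliMatrix p.1 p.2) =
      ⊤ := by
  classical
  refine eq_top_iff.2 fun m _ => ?_
  have expansion (x : Λ → ZMod 2) : ∃ c : (Λ → ZMod 2) → ℂ,
      ∑ z, c z • (fun s => sign (z ⬝ᵥ s)) = fun s : Λ → ZMod 2 => m s (s + x) :=
    (Submodule.mem_span_range_iff_exists_fun ℂ).1 (span_range_walsh Λ ▸ Submodule.mem_top)
  choose c hc using expansion
  have hm : m = ∑ x, ∑ z, c x z • pauliMatrix x z := by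
    refine Matrix.ext fun (s t : Λ → ZMod 2) => ?_
    have shift : s + (s + t) = t := by rw [← add_assoc, ZModModule.add_self, zero_add]
    have diagonal : ∑ z, c (s + t) z * sign (z ⬝ᵥ s) = m s t := by
      have h := congrFun (hc (s + t)) s
      rw [Finset.sum_apply] at h
      exact h.trans (congrArg (m s) shift)
    have off_diagonal (x : Λ → ZMod 2) (hx : x ≠ s + t) (z : Λ → ZMod 2) :
        (c x z • pauliMatrix x z : LocalMatrix Λ) s t = 0 :=
      mul_eq_zero_of_right _ (if_neg fun h => hx (by
        rw [h, ← add_assoc, ZModModule.add_self, zero_add]))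
    symm
    refine (Matrix.sum_apply s t _ _).trans
      ((Fintype.sum_eq_single (s + t) fun x hx => ?_).trans ?_)
    · exact (Matrix.sum_apply s t _ _).trans (Finset.sum_eq_zero fun z _ => off_diagonal x hx z)
    · refine (Matrix.sum_apply s t _ _).trans (Eq.trans ?_ diagonal)
      exact Finset.sum_congr rfl fun z _ => congrArg (c (s + t) z * ·) (if_pos shift.symm)
  rw [hm]
  exact sum_mem fun x _ => sum_mem fun z _ =>
    Submodule.smul_mem _ _ (Submodule.subset_span ⟨(x, z), rfl⟩)

variable [DecidableEq E]

/-- An element of `𝒜_Λ`, as an element of the quasi-local algebra. -/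
def localElt (Λ : Finset E) : LocalMatrix Λ →⋆ₐ[ℂ] QuasiLocal E :=
  (localEmbed Λ).codRestrict (quasiLocal E) (localEmbed_mem Λ)

theorem ext_amplitude {a b : QuasiLocal E}
    (h : ∀ ψ s, amplitude (a.1 ψ) s = amplitude (b.1 ψ) s) : a = b :=
  Subtype.ext (ContinuousLinearMap.ext fun ψ => lp.ext (funext (h ψ)))

/-- The Pauli string `Z^z X^x` labelled by `p = (x, z)`; it has no phase, so that it is
self-adjoint only if `z · x = 0`. -/
def pauliString (p : PauliVector E) : QuasiLocal E :=
  localElt (p.1.support ∪ p.2.support) (pauliMatrix (fun e => p.1 e) fun e => p.2 e)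

theorem amplitude_localElt_pauliMatrix {Λ : Finset E} {p : PauliVector E} (hx : p.1.support ⊆ Λ)
    (hz : p.2.support ⊆ Λ) (ψ : ConfigSpace E) (s : E → ZMod 2) :
    amplitude ((localElt Λ (pauliMatrix (fun e => p.1 e) fun e => p.2 e)).1 ψ) s =
      sign (pairing p.2 s) * amplitude ψ (s + ⇑p.1) := by
  have shift : patch Λ s (fun e : Λ => s e + p.1 e) = s + ⇑p.1 := by
    funext e
    by_cases he : e ∈ Λ
    · exact dif_pos he
    · have hx : p.1 e = 0 := Finsupp.notMem_support_iff.1 fun h => he (hx h)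
      rw [Pi.add_apply, hx, add_zero]
      exact dif_neg he
  rw [pairing_eq_sum hz]
  refine (Fintype.sum_eq_single (fun e : Λ => s e + p.1 e) fun t ht => ?_).trans ?_
  · exact mul_eq_zero_of_left (if_neg ht) _
  · refine congrArg₂ (· * ·) ((if_pos rfl).trans ?_) (congrArg (amplitude ψ) shift)
    exact congrArg sign (Finset.sum_coe_sort _ fun e => p.2 e * s e)

theorem amplitude_pauliString (p : PauliVector E) (ψ : ConfigSpace E) (s : E → ZMod 2) :
    amplitude ((pauliString p).1 ψ) s = sign (pairing p.2 s) * amplitude ψ (s + ⇑p.1) :=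
  amplitude_localElt_pauliMatrix Finset.subset_union_left Finset.subset_union_right ψ s

theorem pauliString_zero : pauliString (0 : PauliVector E) = 1 :=
  ext_amplitude fun ψ s => by
    rw [amplitude_pauliString]
    simp only [Prod.fst_zero, Prod.snd_zero, map_zero, LinearMap.zero_apply, Finsupp.coe_zero,
      add_zero, AddChar.map_zero_eq_one, one_mul]
    rfl

theorem pauliString_mul (p q : PauliVector E) :
    pauliString p * pauliString q = sign (pairing q.2 p.1) • pauliString (p + q) :=
  ext_amplitude fun ψ s => by
    change amplitude ((pauliString p).1 ((pauliString q).1 ψ)) s =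
      sign (pairing q.2 p.1) * amplitude ((pauliString (p + q)).1 ψ) s
    simp only [amplitude_pauliString, Prod.fst_add, Prod.snd_add, map_add, LinearMap.add_apply,
      Finsupp.coe_add, AddChar.map_add_eq_mul, add_assoc]
    ring

theorem pauliString_mul_comm (p q : PauliVector E) :
    pauliString p * pauliString q =
      sign (symplecticForm p q) • (pauliString q * pauliString p) := by
  rw [pauliString_mul, pauliString_mul, smul_smul, add_comm q, symplecticForm,
    AddChar.map_add_eq_mul, mul_right_comm, sign_mul_self, one_mul]

theorem star_pauliString (p : PauliVector E) :
    star (pauliString p) = sign (pairing p.2 p.1) • pauliString p := by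
  rw [pauliString, ← map_star, star_pauliMatrix, map_smul, pairing_eq_sum Finset.subset_union_right]
  exact congrArg (fun c => sign c • localElt _ _) (Finset.sum_coe_sort _ fun e => p.2 e * p.1 e)

theorem pauliString_mul_self (p : PauliVector E) :
    pauliString p * pauliString p = sign (pairing p.2 p.1) • (1 : QuasiLocal E) := by
  rw [pauliString_mul, ← pauliString_zero, ZModModule.add_self]

theorem pauliString_mem_unitary (p : PauliVector E) : pauliString p ∈ unitary (QuasiLocal E) := by
  have h : sign (pairing p.2 p.1) • (pauliString p * pauliString p) = 1 := by
    rw [pauliString_mul_self, smul_smul, sign_mul_self, one_smul]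
  exact Unitary.mem_iff.2 ⟨by rw [star_pauliString, smul_mul_assoc, h],
    by rw [star_pauliString, mul_smul_comm, h]⟩

theorem amplitude_siteOp (e : E) (m : Matrix (Fin 2) (Fin 2) ℂ) (ψ : ConfigSpace E)
    (s : E → ZMod 2) :
    amplitude ((siteOp e m).1 ψ) s =
      ∑ k : Fin 2, m (s e) k * amplitude ψ (Function.update s e k) := by
  refine Fintype.sum_equiv (Equiv.funUnique ({e} : Finset E) (Fin 2))
    (fun t => m (s e) (t default) * amplitude ψ (patch {e} s t)) _ fun t => ?_
  refine congrArg (fun s' : E → ZMod 2 => m (s e) (t default) * amplitude ψ s')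
    (funext fun e' => ?_)
  by_cases h : e' = e
  · subst h
    exact (dif_pos (Finset.mem_singleton_self e')).trans (Function.update_self e' _ s).symm
  · exact (dif_neg (Finset.notMem_singleton.2 h)).trans (Function.update_of_ne h _ s).symm

theorem sigmaX_eq_pauliString (e : E) : sigmaX e = pauliString (Finsupp.single e 1, 0) :=
  ext_amplitude fun ψ s => by
    have flip : s + ⇑(Finsupp.single e (1 : ZMod 2)) = Function.update s e (s e + 1) := by
      funext e'
      by_cases h : e' = e
      · subst h
        simp
      · simp [h]
    rw [amplitude_pauliString, sigmaX, amplitude_siteOp, Fin.sum_univ_two, flip, map_zero,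
      LinearMap.zero_apply, AddChar.map_zero_eq_one, one_mul]
    rcases zmod_two_eq_zero_or_one (s e) with h | h <;> rw [h]
    · exact (congrArg₂ (· + ·) (zero_mul _) (one_mul _)).trans (zero_add _)
    · exact (congrArg₂ (· + ·) (one_mul _) (zero_mul _)).trans (add_zero _)

theorem sigmaZ_eq_pauliString (e : E) : sigmaZ e = pauliString (0, Finsupp.single e 1) :=
  ext_amplitude fun ψ s => by
    rw [amplitude_pauliString, sigmaZ, amplitude_siteOp, Fin.sum_univ_two, pairing_single,
      Finsupp.coe_zero, add_zero]
    rcases zmod_two_eq_zero_or_one (s e) with h | h <;>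
      have stay := congrArg (amplitude ψ) (Function.update_eq_self_iff.2 h.symm) <;> rw [h]
    · rw [AddChar.map_zero_eq_one]
      exact (congrArg₂ (1 * · + ·) stay (zero_mul _)).trans (add_zero _)
    · rw [sign_one]
      exact (congrArg₂ (· + -1 * ·) (zero_mul _) stay).trans (zero_add _)

theorem pauliString_mem_of_mem_span {B : Subalgebra ℂ (QuasiLocal E)} {T : Set (PauliVector E)}
    (hT : ∀ q ∈ T, pauliString q ∈ B) {p : PauliVector E}
    (hp : p ∈ Submodule.span (ZMod 2) T) : pauliString p ∈ B := by
  induction hp using Submodule.span_induction with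
  | mem q hq => exact hT q hq
  | zero => exact pauliString_zero (E := E) ▸ one_mem B
  | add p q _ _ hp hq =>
    have h : pauliString (p + q) = sign (pairing q.2 p.1) • (pauliString p * pauliString q) := by
      rw [pauliString_mul, smul_smul, sign_mul_self, one_smul]
    exact h ▸ B.smul_mem (mul_mem hp hq) _
  | smul c p _ hp =>
    rcases zmod_two_eq_zero_or_one c with rfl | rfl
    · rw [zero_smul, pauliString_zero]
      exact one_mem B
    · rwa [one_smul]

theorem localElt_mem_span_pauliString (Λ : Finset E) (m : LocalMatrix Λ) :
    localElt Λ m ∈ Submodule.span ℂ (Set.range (pauliString (E := E))) := by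
  have hm : m ∈ Submodule.span ℂ
      (Set.range fun p : (Λ → ZMod 2) × (Λ → ZMod 2) => pauliMatrix p.1 p.2) :=
    span_range_pauliMatrix Λ ▸ Submodule.mem_top
  have h := Submodule.mem_map_of_mem (f := (localElt Λ : LocalMatrix Λ →ₗ[ℂ] QuasiLocal E)) hm
  rw [Submodule.map_span] at h
  refine Submodule.span_mono ?_ h
  rintro _ ⟨_, ⟨⟨x, z⟩, rfl⟩, rfl⟩
  let extend (y : Λ → ZMod 2) : E →₀ ZMod 2 :=
    (Finsupp.equivFunOnFinite.symm y).extendDomain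
  have extend_coe (y : Λ → ZMod 2) : (fun e : Λ => extend y e) = y :=
    funext fun e => dif_pos e.2
  have support (y : Λ → ZMod 2) : (extend y).support ⊆ Λ :=
    Finsupp.support_extendDomain_subset _
  refine ⟨(extend x, extend z), ext_amplitude fun ψ s => ?_⟩
  rw [amplitude_pauliString]
  have h := amplitude_localElt_pauliMatrix (p := (extend x, extend z)) (support x) (support z) ψ s
  rw [extend_coe, extend_coe] at h
  exact h.symm

theorem range_localElt_mono {Λ Λ' : Finset E} (h : Λ ⊆ Λ') :
    (localElt Λ).range ≤ (localElt Λ').range := by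
  rintro _ ⟨a, rfl⟩
  exact ⟨extendMatrix h a, Subtype.ext (localEmbed_extendMatrix h a)⟩

theorem dense_iUnion_range_localElt :
    Dense (⋃ Λ : Finset E, ((localElt Λ).range : Set (QuasiLocal E))) := by
  intro a
  have directed : Directed (· ≤ ·) fun Λ : Finset E => (localEmbed Λ).range :=
    Monotone.directed_le fun Λ Λ' h => by
      rintro _ ⟨m, rfl⟩
      exact ⟨extendMatrix h m, localEmbed_extendMatrix h m⟩
  have ha : a.1 ∈ closure (localAlgebra E : Set (ConfigSpace E →L[ℂ] ConfigSpace E)) := by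
    rw [← StarSubalgebra.topologicalClosure_coe]
    exact a.2
  rw [localAlgebra, StarSubalgebra.coe_iSup_of_directed directed] at ha
  rw [closure_subtype]
  refine closure_mono (Set.iUnion_subset fun Λ => ?_) ha
  rintro _ ⟨m, rfl⟩
  exact ⟨localElt Λ m, Set.mem_iUnion.2 ⟨Λ, m, rfl⟩, rfl⟩

theorem dense_span_range_pauliString :
    Dense (Submodule.span ℂ (Set.range (pauliString (E := E))) : Set (QuasiLocal E)) := by
  refine dense_iUnion_range_localElt.mono (Set.iUnion_subset fun Λ => ?_)
  rintro _ ⟨m, rfl⟩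
  exact localElt_mem_span_pauliString Λ m

theorem nonempty_range_localElt_equiv {Λ : Finset E} {n : ℕ} (card : Λ.card = n) :
    Nonempty ((localElt Λ).range ≃⋆ₐ[ℂ] Matrix (Fin (2 ^ n)) (Fin (2 ^ n)) ℂ) := by
  have injective : Function.Injective (localElt Λ) :=
    (StarAlgHom.injective_codRestrict (localEmbed Λ) (quasiLocal E) (localEmbed_mem Λ)).2
      (localEmbed_injective Λ)
  let e : (Λ → Fin 2) ≃ Fin (2 ^ n) := Fintype.equivFinOfCardEq (by simp [card])
  exact ⟨(StarAlgEquiv.ofInjective _ injective).symm.trans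
    (StarAlgEquiv.ofAlgEquiv (Matrix.reindexAlgEquiv ℂ ℂ e) fun _ => rfl)⟩

theorem isUHFTwoInfty_quasiLocal [Countable E] [Infinite E] : IsUHFTwoInfty (QuasiLocal E) := by
  obtain ⟨e⟩ : Nonempty (E ≃ ℕ) := nonempty_equiv_of_countable
  let Λ (n : ℕ) : Finset E := (Finset.range n).map e.symm.toEmbedding
  have mem_Λ (n : ℕ) (x : E) : x ∈ Λ n ↔ e x < n := by simp [Λ]
  refine ⟨fun n => (localElt (Λ n)).range, fun m n hmn => range_localElt_mono fun x hx => ?_,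
    fun n => nonempty_range_localElt_equiv (by simp [Λ]), StarSubalgebra.eq_top_iff.2 fun a => ?_⟩
  · exact (mem_Λ n x).2 (((mem_Λ m x).1 hx).trans_le hmn)
  · refine closure_mono (Set.iUnion_subset fun Γ => ?_) (dense_iUnion_range_localElt a)
    have subset : Γ ⊆ Λ (Γ.sup e + 1) := fun x hx =>
      (mem_Λ _ x).2 (Nat.lt_succ_of_le (Finset.le_sup (f := e) hx))
    exact (range_localElt_mono subset).trans (le_iSup (fun n => (localElt (Λ n)).range) _)

theorem pairing_eval_single {E : Type*} (l : (E →₀ ZMod 2) →ₗ[ZMod 2] ZMod 2)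
    (y : E →₀ ZMod 2) : pairing y (fun e => l (Finsupp.single e 1)) = l y := by
  have h : (pairing.flip fun e => l (Finsupp.single e 1)) = l :=
    Finsupp.lhom_ext' fun e => LinearMap.ext_ring (pairing_single e _)
  exact LinearMap.congr_fun h y

theorem exists_symplecticForm_eq {E : Type*} (φ : PauliVector E →ₗ[ZMod 2] ZMod 2)
    (Λ : Finset E) : ∃ p, ∀ q : PauliVector E, q.1.support ⊆ Λ → q.2.support ⊆ Λ →
      symplecticForm q p = φ q := by
  classical
  refine ⟨(Finsupp.indicator Λ fun e _ => φ (0, Finsupp.single e 1),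
    Finsupp.indicator Λ fun e _ => φ (Finsupp.single e 1, 0)), fun q hx hz => ?_⟩
  have h : φ q = φ.comp (LinearMap.inl _ _ _) q.1 + φ.comp (LinearMap.inr _ _ _) q.2 := by
    simp [← map_add]
  rw [h, ← pairing_eval_single _ q.1, ← pairing_eval_single _ q.2, symplecticForm,
    pairing_comm _ q.1, pairing_eq_sum hx, pairing_eq_sum hz, pairing_eq_sum hx,
    pairing_eq_sum hz, add_comm]
  refine congrArg₂ (· + ·) (Finset.sum_congr rfl fun e he => ?_)
    (Finset.sum_congr rfl fun e he => ?_)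
  all_goals
    rw [Finsupp.indicator_of_mem he]
    rfl

variable {W : Type*} {P : W → PauliVector E}

/-- The Pauli vectors `P w` label a complete stabilizer code: the Pauli strings `pauliString (P w)`
are self-adjoint, commuting and independent, and no other Pauli string commutes with all of them
except for those that they generate. -/
structure IsStabilizerCode {E W : Type*} (P : W → PauliVector E) : Prop where
  linearIndependent : LinearIndependent (ZMod 2) P
  pairing_eq_zero w : pairing (P w).2 (P w).1 = 0
  isotropic w w' : symplecticForm (P w) (P w') = 0
  maximal p : (∀ w, symplecticForm (P w) p = 0) → p ∈ Submodule.span (ZMod 2) (Set.range P)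

instance : Nontrivial (ConfigSpace E) where
  exists_pair_ne := by
    classical
    refine ⟨lp.single 2 0 1, 0, fun h => ?_⟩
    have value := lp.single_apply_self (E := fun _ : Config E => ℂ) 2 0 1
    rw [h] at value
    exact zero_ne_one value

theorem isSymmetry_pauliString {p : PauliVector E} (hp : pairing p.2 p.1 = 0) :
    IsSymmetry (pauliString p) where
  isSelfAdjoint := by
    rw [isSelfAdjoint_iff, star_pauliString, hp, AddChar.map_zero_eq_one, one_smul]
  mul_self := by rw [pauliString_mul_self, hp, AddChar.map_zero_eq_one, one_smul]

theorem commute_pauliString_iff {p q : PauliVector E} :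
    Commute (pauliString p) (pauliString q) ↔ symplecticForm p q = 0 := by
  have ne_zero : pauliString q * pauliString p ≠ 0 :=
    (Unitary.isUnit_coe (U := ⟨_, mul_mem (pauliString_mem_unitary q)
      (pauliString_mem_unitary p)⟩)).ne_zero
  have cancel : sign (symplecticForm p q) • (pauliString q * pauliString p) =
      (1 : ℂ) • (pauliString q * pauliString p) ↔ sign (symplecticForm p q) = 1 :=
    (smul_left_injective ℂ ne_zero).eq_iff
  rw [commute_iff_eq, pauliString_mul_comm, ← sign_injective.eq_iff, AddChar.map_zero_eq_one,
    ← cancel, one_smul]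

theorem pauliString_anticommute {p q : PauliVector E} (h : symplecticForm p q = 1) :
    pauliString p * pauliString q = -(pauliString q * pauliString p) := by
  rw [pauliString_mul_comm, h, sign_one, neg_one_smul]

namespace IsStabilizerCode

theorem isStabilizerSystem (h : IsStabilizerCode P) :
    IsStabilizerSystem (fun w => pauliString (P w)) (Set.range pauliString) where
  isSymmetry w := isSymmetry_pauliString (h.pairing_eq_zero w)
  commute w w' := commute_pauliString_iff.2 (h.isotropic w w')
  dense_span := dense_span_range_pauliString
  subset_unitary := Set.range_subset_iff.2 pauliString_mem_unitary
  commute_or_anticommute := by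
    rintro _ ⟨p, rfl⟩ w
    exact (zmod_two_eq_zero_or_one (symplecticForm (P w) p)).imp commute_pauliString_iff.2
      pauliString_anticommute
  mem_generated := by
    rintro _ ⟨p, rfl⟩ hp
    exact pauliString_mem_of_mem_span (B := (generated fun w => pauliString (P w)).toSubalgebra)
      (Set.forall_mem_range.2 fun w => mem_generated (fun w => pauliString (P w)) w)
      (h.maximal p fun w => commute_pauliString_iff.1 (hp w))

theorem signsFlippable (h : IsStabilizerCode P) :
    SignsFlippable fun w => pauliString (P w) := by
  classical
  intro F w hw
  obtain ⟨g, hg⟩ := LinearMap.exists_leftInverse_of_injective _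
    (linearIndependent_iff_ker.1 h.linearIndependent)
  have hg (j : W) : g (P j) = Finsupp.single j 1 := by
    simpa using LinearMap.congr_fun hg (Finsupp.single j 1)
  obtain ⟨p, hp⟩ := exists_symplecticForm_eq ((Finsupp.lapply w).comp g)
    ((insert w F).biUnion fun j => (P j).1.support ∪ (P j).2.support)
  have flips (j : W) (hj : j ∈ insert w F) :
      symplecticForm (P j) p = Finsupp.single j (1 : ZMod 2) w := by
    have support := Finset.subset_biUnion_of_mem (fun j => (P j).1.support ∪ (P j).2.support) hj
    rw [hp (P j) (Finset.subset_union_left.trans support)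
      (Finset.subset_union_right.trans support), LinearMap.comp_apply, hg, Finsupp.lapply_apply]
  refine ⟨pauliString p, pauliString_mem_unitary p, pauliString_anticommute ?_,
    fun j hj => commute_pauliString_iff.2 ?_⟩
  · rw [flips w (Finset.mem_insert_self w F), Finsupp.single_eq_same]
  · rw [flips j (Finset.mem_insert_of_mem hj), Finsupp.single_eq_of_ne]
    exact (ne_of_mem_of_not_mem hj hw).symm

theorem exists_isSignState (h : IsStabilizerCode P) (f : W → ℤˣ) :
    ∃ φ, IsSignState (fun w => pauliString (P w)) f φ := by
  obtain ⟨φ, hφ⟩ := exists_isState (ConfigSpace E)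
  exact CStarDiagonal.exists_isSignState ⟨restriction (quasiLocal E) φ, hφ.restriction _⟩
    h.isStabilizerSystem.isSymmetry h.isStabilizerSystem.commute h.signsFlippable f

end IsStabilizerCode

theorem isStabilizerCode_css {E V F : Type*} {ξ : V → E →₀ ZMod 2}
    {ζ : F → E →₀ ZMod 2} (hξ : LinearIndependent (ZMod 2) ξ) (hζ : LinearIndependent (ZMod 2) ζ)
    (orthogonal : ∀ v p, pairing (ξ v) (ζ p) = 0)
    (exact_ξ : ∀ x : E →₀ ZMod 2, (∀ p, pairing (ζ p) x = 0) →
      x ∈ Submodule.span (ZMod 2) (Set.range ξ))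
    (exact_ζ : ∀ z : E →₀ ZMod 2, (∀ v, pairing (ξ v) z = 0) →
      z ∈ Submodule.span (ZMod 2) (Set.range ζ)) :
    IsStabilizerCode (Sum.elim (fun v => (ξ v, 0)) fun p => (0, ζ p) : V ⊕ F → PauliVector E) where
  linearIndependent := linearIndependent_inl_union_inr' hξ hζ
  pairing_eq_zero := by
    rintro (v | p) <;> simp
  isotropic := by
    rintro (v | p) (w | q)
    · simp [symplecticForm]
    · simpa [symplecticForm, pairing_comm] using orthogonal v q
    · simpa [symplecticForm, pairing_comm] using orthogonal w p
    · simp [symplecticForm]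
  maximal := by
    rintro ⟨x, z⟩ h
    have hx : x ∈ Submodule.span (ZMod 2) (Set.range ξ) := exact_ξ x fun p => by
      simpa [symplecticForm, pairing_comm] using h (.inr p)
    have hz : z ∈ Submodule.span (ZMod 2) (Set.range ζ) := exact_ζ z fun v => by
      simpa [symplecticForm, pairing_comm] using h (.inl v)
    have mem : (x, z) ∈ (Submodule.span (ZMod 2) (Set.range ξ)).prod
        (Submodule.span (ZMod 2) (Set.range ζ)) := ⟨hx, hz⟩
    rwa [← LinearMap.span_inl_union_inr, ← Set.range_comp, ← Set.range_comp,
      ← Set.Sum.elim_range] at mem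

end SpinSystem

namespace ToricCode

open SpinSystem CStarDiagonal

section Difference

variable {G M : Type*} [AddCommGroup G] [AddCommGroup M]

/-- The difference operator `g ↦ g - g (· - d)` on finitely supported functions. -/
def difference (d : G) : (G →₀ M) →+ (G →₀ M) :=
  AddMonoidHom.id _ - Finsupp.mapDomain.addMonoidHom (· + d)

theorem difference_apply (d : G) (g : G →₀ M) (x : G) :
    difference d g x = g x - g (x - d) := by
  have h : Finsupp.mapDomain (· + d) g x = g (x - d) := by
    conv_lhs => rw [← sub_add_cancel x d]
    exact Finsupp.mapDomain_apply (add_left_injective d) g (x - d)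
  exact congrArg (g x - ·) h

theorem difference_single (d x : G) (m : M) :
    difference d (Finsupp.single x m) = Finsupp.single x m - Finsupp.single (x + d) m :=
  congrArg (Finsupp.single x m - ·) Finsupp.mapDomain_single

theorem difference_comm (a b : G) (g : G →₀ M) :
    difference a (difference b g) = difference b (difference a g) := by
  ext x
  simp only [difference_apply, sub_right_comm x a b]
  abel

theorem mapDomain_difference {G' : Type*} [AddCommGroup G'] (π : G →+ G') (d : G) (g : G →₀ M) :
    (difference d g).mapDomain π = difference (π d) (g.mapDomain π) := by
  induction g using Finsupp.induction_linear with
  | zero => simp only [map_zero, Finsupp.mapDomain_zero]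
  | add g h hg hh => simp only [map_add, Finsupp.mapDomain_add, hg, hh]
  | single x m =>
    rw [difference_single, Finsupp.mapDomain_single, difference_single, ← map_add]
    exact (map_sub (Finsupp.mapDomain.addMonoidHom (M := M) π) _ _).trans
      (congrArg₂ (· - ·) Finsupp.mapDomain_single Finsupp.mapDomain_single)

theorem difference_injective [IsAddTorsionFree G] {d : G} (hd : d ≠ 0) :
    Function.Injective (difference d : (G →₀ M) →+ (G →₀ M)) := by
  refine (injective_iff_map_eq_zero _).2 fun g hg => Finsupp.ext fun x => ?_
  by_contra hx
  have periodic (n : ℕ) : g (x + n • d) = g x := by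
    induction n with
    | zero => rw [zero_nsmul, add_zero]
    | succ n ih =>
      have h := DFunLike.congr_fun hg (x + (n + 1) • d)
      rw [difference_apply, Finsupp.zero_apply, sub_eq_zero] at h
      rw [h, succ_nsmul, ← add_assoc, add_sub_cancel_right, ih]
  refine (infinite_range_add_nsmul_iff x d).2 hd (g.support.finite_toSet.subset ?_)
  rintro _ ⟨n, rfl⟩
  exact Finsupp.mem_support_iff.2 ((periodic n).symm ▸ hx)

theorem single_sub_single_mem_range_difference {a d : G} (hd : d ∈ AddSubgroup.zmultiples a)
    (x : G) (m : M) :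
    Finsupp.single x m - Finsupp.single (x + d) m ∈
      (difference a : (G →₀ M) →+ (G →₀ M)).range := by
  rw [AddSubgroup.zmultiples_eq_closure] at hd
  induction hd using AddSubgroup.closure_induction generalizing x with
  | mem d hd => exact ⟨Finsupp.single x m, Set.mem_singleton_iff.1 hd ▸ difference_single a x m⟩
  | zero => rw [add_zero, sub_self]; exact zero_mem _
  | add d d' _ _ hd hd' =>
    rw [← add_assoc, ← sub_add_sub_cancel _ (Finsupp.single (x + d) m)]
    exact add_mem (hd x) (hd' (x + d))
  | neg d _ hd =>
    rw [← neg_sub]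
    nth_rw 2 [← neg_add_cancel_right x d]
    exact neg_mem (hd (x + -d))

/-- A discrete Poincaré lemma for finitely supported functions. -/
theorem exists_difference_eq {G' : Type*} [AddCommGroup G'] [IsAddTorsionFree G]
    [IsAddTorsionFree G'] (π : G →+ G') {a b : G} (hker : π.ker = AddSubgroup.zmultiples a)
    (ha : a ≠ 0) (hb : π b ≠ 0) {h v : G →₀ M} (closed : difference a h = difference b v) :
    ∃ g, difference b g = h ∧ difference a g = v := by
  have fiber_sum : v.mapDomain π = 0 := by
    have πa : π a = 0 := π.mem_ker.1 (hker ▸ AddSubgroup.mem_zmultiples a)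
    refine difference_injective hb ?_
    rw [← mapDomain_difference, ← closed, mapDomain_difference, πa, map_zero]
    ext x
    rw [difference_apply, sub_zero, sub_self, Finsupp.zero_apply]
  have exact_along_fibers (u : G →₀ M) :
      u - u.mapDomain (Function.invFun π ∘ π) ∈
        (difference a : (G →₀ M) →+ (G →₀ M)).range := by
    induction u using Finsupp.induction_linear with
    | zero => rw [Finsupp.mapDomain_zero, sub_self]; exact zero_mem _
    | add u u' hu hu' =>
      rw [Finsupp.mapDomain_add, add_sub_add_comm]
      exact add_mem hu hu'
    | single x m =>
      rw [Finsupp.mapDomain_single]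
      rw [← add_sub_cancel x ((Function.invFun π ∘ π) x)]
      refine single_sub_single_mem_range_difference ?_ x m
      rw [← hker, AddMonoidHom.mem_ker, map_sub, sub_eq_zero]
      exact Function.invFun_eq ⟨x, rfl⟩
  obtain ⟨g, hg⟩ := exact_along_fibers v
  rw [Finsupp.mapDomain_comp, fiber_sum, Finsupp.mapDomain_zero, sub_zero] at hg
  exact ⟨g, difference_injective ha (by rw [difference_comm, hg, closed]), hg⟩

end Difference

theorem linearCombination_apply_eq_difference {R G E : Type*} [CommRing R] [AddCommGroup G]
    {ζ : G → E →₀ R} {e : E} {d x : G}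
    (h : ∀ p, ζ p e = difference d (Finsupp.single p 1) x) (g : G →₀ R) :
    Finsupp.linearCombination R ζ g e = difference d g x := by
  induction g using Finsupp.induction_linear with
  | zero => simp only [map_zero, Finsupp.zero_apply]
  | add f g hf hg => simp only [map_add, Finsupp.add_apply, hf, hg]
  | single p k =>
    rw [Finsupp.linearCombination_single, Finsupp.smul_apply, h, difference_apply,
      difference_apply, smul_eq_mul, mul_sub, ← smul_eq_mul, ← Finsupp.smul_apply,
      Finsupp.smul_single_one, ← smul_eq_mul, ← Finsupp.smul_apply, Finsupp.smul_single_one]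

section EdgeChains

variable {ζ : ℤ × ℤ → Edge →₀ ZMod 2} {a b : ℤ × ℤ}

theorem linearIndependent_of_apply_hEdge
    (hζ : ∀ p x, ζ p (hEdge x) = difference b (Finsupp.single p 1) x) (hb : b ≠ 0) :
    LinearIndependent (ZMod 2) ζ := by
  refine linearIndependent_iff.2 fun g hg => difference_injective hb ?_
  ext x
  rw [← linearCombination_apply_eq_difference fun p => hζ p x, hg, map_zero, Finsupp.zero_apply,
    Finsupp.zero_apply]

theorem mem_span_range_of_closed
    (hEdge_apply : ∀ p x, ζ p (hEdge x) = difference b (Finsupp.single p 1) x)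
    (vEdge_apply : ∀ p x, ζ p (vEdge x) = difference a (Finsupp.single p 1) x)
    (π : ℤ × ℤ →+ ℤ) (hker : π.ker = AddSubgroup.zmultiples a) (ha : a ≠ 0) (hb : π b ≠ 0)
    {z : Edge →₀ ZMod 2}
    (closed : ∀ x, z (hEdge x) - z (hEdge (x - a)) = z (vEdge x) - z (vEdge (x - b))) :
    z ∈ Submodule.span (ZMod 2) (Set.range ζ) := by
  let h := z.comapDomain hEdge (Prod.mk_left_injective false).injOn
  let v := z.comapDomain vEdge (Prod.mk_left_injective true).injOn
  obtain ⟨g, hg, hg'⟩ := exists_difference_eq π hker ha hb (h := h) (v := v) <|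
    Finsupp.ext fun x => by
      rw [difference_apply, difference_apply]
      exact closed x
  refine (Finsupp.mem_span_range_iff_exists_finsupp).2 ⟨g, ?_⟩
  change Finsupp.linearCombination (ZMod 2) ζ g = z
  ext ⟨x, _ | _⟩
  · exact (linearCombination_apply_eq_difference (fun p => hEdge_apply p x) g).trans
      (DFunLike.congr_fun hg x)
  · exact (linearCombination_apply_eq_difference (fun p => vEdge_apply p x) g).trans
      (DFunLike.congr_fun hg' x)

end EdgeChains

/-- The indicator function of the star of `v`. -/
def starVec (v : Vertex) : Edge →₀ ZMod 2 :=
  .single (hEdge v) 1 + .single (vEdge v) 1 + .single (hEdge (v - (1, 0))) 1 +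
    .single (vEdge (v - (0, 1))) 1

/-- The indicator function of the boundary of `p`. -/
def faceVec (p : Face) : Edge →₀ ZMod 2 :=
  .single (hEdge p) 1 + .single (vEdge p) 1 + .single (hEdge (p + (0, 1))) 1 +
    .single (vEdge (p + (1, 0))) 1

theorem starOp_eq_pauliString (v : Vertex) : starOp v = pauliString (starVec v, 0) := by
  simp only [starOp, sigmaX_eq_pauliString, pauliString_mul, map_zero, LinearMap.zero_apply,
    AddChar.map_zero_eq_one, one_smul, Prod.mk_add_mk, add_zero, starVec]

theorem faceOp_eq_pauliString (p : Face) : faceOp p = pauliString (0, faceVec p) := by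
  simp only [faceOp, sigmaZ_eq_pauliString, pauliString_mul, Finsupp.coe_zero, map_zero,
    AddChar.map_zero_eq_one, one_smul, Prod.mk_add_mk, add_zero, faceVec]

theorem pairing_starVec (v : Vertex) (s : Edge → ZMod 2) :
    pairing (starVec v) s =
      s (hEdge v) + s (vEdge v) + s (hEdge (v - (1, 0))) + s (vEdge (v - (0, 1))) := by
  simp only [starVec, map_add, LinearMap.add_apply, pairing_single]

theorem pairing_faceVec (p : Face) (s : Edge → ZMod 2) :
    pairing (faceVec p) s =
      s (hEdge p) + s (vEdge p) + s (hEdge (p + (0, 1))) + s (vEdge (p + (1, 0))) := by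
  simp only [faceVec, map_add, LinearMap.add_apply, pairing_single]

theorem starVec_hEdge (v x : Vertex) :
    starVec v (hEdge x) = difference (-(1, 0)) (Finsupp.single v 1) x := by
  rw [difference_apply, sub_neg_eq_add, CharTwo.sub_eq_add]
  simp [starVec, Finsupp.single_apply, hEdge, vEdge, sub_eq_iff_eq_add]

theorem starVec_vEdge (v x : Vertex) :
    starVec v (vEdge x) = difference (-(0, 1)) (Finsupp.single v 1) x := by
  rw [difference_apply, sub_neg_eq_add, CharTwo.sub_eq_add]
  simp [starVec, Finsupp.single_apply, hEdge, vEdge, sub_eq_iff_eq_add]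

theorem faceVec_hEdge (p : Face) (x : Vertex) :
    faceVec p (hEdge x) = difference (0, 1) (Finsupp.single p 1) x := by
  rw [difference_apply, CharTwo.sub_eq_add]
  simp [faceVec, Finsupp.single_apply, hEdge, vEdge, eq_sub_iff_add_eq]

theorem faceVec_vEdge (p : Face) (x : Vertex) :
    faceVec p (vEdge x) = difference (1, 0) (Finsupp.single p 1) x := by
  rw [difference_apply, CharTwo.sub_eq_add]
  simp [faceVec, Finsupp.single_apply, hEdge, vEdge, eq_sub_iff_add_eq]

theorem pairing_starVec_faceVec (v : Vertex) (p : Face) :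
    pairing (starVec v) (faceVec p) = 0 := by
  simp only [pairing_starVec, faceVec_hEdge, faceVec_vEdge, difference_apply, CharTwo.sub_eq_add,
    sub_right_comm v (0, 1) (1, 0)]
  grind

theorem ker_fst_eq_zmultiples : (AddMonoidHom.fst ℤ ℤ).ker = AddSubgroup.zmultiples (-(0, 1)) := by
  ext ⟨i, j⟩
  rw [AddSubgroup.zmultiples_neg, AddMonoidHom.mem_ker]
  simp [AddSubgroup.mem_zmultiples_iff, eq_comm]

theorem ker_snd_eq_zmultiples : (AddMonoidHom.snd ℤ ℤ).ker = AddSubgroup.zmultiples (1, 0) := by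
  ext ⟨i, j⟩
  rw [AddMonoidHom.mem_ker]
  simp [AddSubgroup.mem_zmultiples_iff, eq_comm]

theorem mem_span_faceVec {z : Edge →₀ ZMod 2} (hz : ∀ v, pairing (starVec v) z = 0) :
    z ∈ Submodule.span (ZMod 2) (Set.range faceVec) := by
  refine mem_span_range_of_closed faceVec_hEdge faceVec_vEdge (AddMonoidHom.snd ℤ ℤ)
    ker_snd_eq_zmultiples (by simp) (by simp) fun v => ?_
  have h := hz v
  rw [pairing_starVec] at h
  simp only [CharTwo.sub_eq_add]
  grind

theorem mem_span_starVec {x : Edge →₀ ZMod 2} (hx : ∀ p, pairing (faceVec p) x = 0) :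
    x ∈ Submodule.span (ZMod 2) (Set.range starVec) := by
  refine mem_span_range_of_closed starVec_hEdge starVec_vEdge (AddMonoidHom.fst ℤ ℤ)
    ker_fst_eq_zmultiples (by simp) (by simp) fun p => ?_
  have h := hx p
  rw [pairing_faceVec] at h
  simp only [sub_neg_eq_add, CharTwo.sub_eq_add]
  grind

/-- The Pauli vector that labels `S_w`. -/
def stabilizerVec : Vertex ⊕ Face → PauliVector Edge :=
  Sum.elim (fun v => (starVec v, 0)) fun p => (0, faceVec p)

theorem isStabilizerCode_stabilizerVec : IsStabilizerCode stabilizerVec :=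
  isStabilizerCode_css
    (linearIndependent_of_apply_hEdge starVec_hEdge (by simp))
    (linearIndependent_of_apply_hEdge faceVec_hEdge (by simp))
    pairing_starVec_faceVec (fun _ => mem_span_starVec) fun _ => mem_span_faceVec

theorem stabilizer_eq_pauliString : stabilizer = fun w => pauliString (stabilizerVec w) :=
  funext <| Sum.rec starOp_eq_pauliString faceOp_eq_pauliString

theorem isStabilizerSystem_stabilizer :
    IsStabilizerSystem stabilizer (Set.range (pauliString (E := Edge))) :=
  stabilizer_eq_pauliString ▸ isStabilizerCode_stabilizerVec.isStabilizerSystem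

theorem exists_isSignState_stabilizer (f : Vertex ⊕ Face → ℤˣ) :
    ∃ φ, IsSignState stabilizer f φ :=
  stabilizer_eq_pauliString ▸ isStabilizerCode_stabilizerVec.exists_isSignState f

theorem isEvaluation_iff_isSignState {f : Vertex ⊕ Face → ℤˣ} {ω : diagonal →L[ℂ] ℂ} :
    IsEvaluation f ω ↔ IsSignState (generator stabilizer) f ω := by
  refine .trans ?_ isStabilizerSystem_stabilizer.isSignState_generator_iff.symm
  exact ⟨fun h => ⟨h.map_one, h.map_mul, h.map_stabilizer⟩,
    fun ⟨h_one, h_mul, h_stab⟩ => ⟨h_one, h_mul, h_stab⟩⟩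

theorem existsUnique_isEvaluation (f : Vertex ⊕ Face → ℤˣ) :
    ∃! ω : diagonal →L[ℂ] ℂ, IsEvaluation f ω := by
  obtain ⟨φ, hφ⟩ := exists_isSignState_stabilizer f
  simp only [isEvaluation_iff_isSignState]
  exact isStabilizerSystem_stabilizer.existsUnique_isSignState_generator hφ

theorem isPureState_iff_exists_isEvaluation (ω : diagonal →L[ℂ] ℂ) :
    IsPureState ω ↔ ∃ f, IsEvaluation f ω := by
  simp only [isEvaluation_iff_isSignState]
  exact isStabilizerSystem_stabilizer.isPureState_generated_iff

theorem IsEvaluation.exists_pure_extension {f : Vertex ⊕ Face → ℤˣ} {ω : diagonal →L[ℂ] ℂ}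
    (h : IsEvaluation f ω) :
    ∃ η : Algebra →L[ℂ] ℂ, IsPureState η ∧ Extends ω η ∧
      ∀ η' : Algebra →L[ℂ] ℂ, IsState η' → Extends ω η' → η' = η := by
  obtain ⟨φ, hφ⟩ := exists_isSignState_stabilizer f
  exact ⟨φ, isStabilizerSystem_stabilizer.exists_pure_extension hφ
    (isEvaluation_iff_isSignState.1 h)⟩

theorem isCStarDiagonal_diagonal : IsCStarDiagonal diagonal :=
  isStabilizerSystem_stabilizer.isCStarDiagonal exists_isSignState_stabilizer

end ToricCode

end

theorem corollary3p7 :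
    -- the quasi-local algebra is the UHF algebra of type `2^∞`
    CStarDiagonal.IsUHFTwoInfty ToricCode.Algebra ∧
    -- every `f` defines exactly one evaluation `ω_f`, and these are the pure states of `𝒞`
    (∀ f : ToricCode.Vertex ⊕ ToricCode.Face → ℤˣ,
      ∃! ω : ToricCode.diagonal →L[ℂ] ℂ, ToricCode.IsEvaluation f ω) ∧
    (∀ ω : ToricCode.diagonal →L[ℂ] ℂ,
      CStarDiagonal.IsPureState ω ↔
        ∃ f : ToricCode.Vertex ⊕ ToricCode.Face → ℤˣ, ToricCode.IsEvaluation f ω) ∧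
    -- every `ω_f` has an extension to a pure state, which is its only extension to a state
    (∀ (f : ToricCode.Vertex ⊕ ToricCode.Face → ℤˣ) (ω : ToricCode.diagonal →L[ℂ] ℂ),
      ToricCode.IsEvaluation f ω →
        ∃ η : ToricCode.Algebra →L[ℂ] ℂ,
          CStarDiagonal.IsPureState η ∧ CStarDiagonal.Extends ω η ∧
          ∀ η' : ToricCode.Algebra →L[ℂ] ℂ,
            CStarDiagonal.IsState η' → CStarDiagonal.Extends ω η' → η' = η) ∧
    -- `𝒞` is a regular masa with the unique extension property
    CStarDiagonal.IsCStarDiagonal ToricCode.diagonal :=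
  ⟨SpinSystem.isUHFTwoInfty_quasiLocal,
    ToricCode.existsUnique_isEvaluation,
    ToricCode.isPureState_iff_exists_isEvaluation,
    fun _ _ h => h.exists_pure_extension,
    ToricCode.isCStarDiagonal_diagonal⟩
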